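/- Let $d\ge 0$ be an integer, $\Gamma=\mathbb Z^d$, and let $\Gamma^*=(\mathbb R/2\pi\mathbb Z)^d$ carry its normalized Haar measure $\mu^*$. Let $\mathcal F:L^2(\Gamma^*)\to\ell^2(\Gamma)$, $[\mathcal F f](x)=\int_{\Gamma^*}e^{i\langle p,x\rangle}f(p)\,d\mu^*(p)$, be the (unitary) Fourier transformation. For $\mathfrak e\in C^2(\Gamma^*;\mathbb R)$ (a dispersion relation) and a bounded potential $V:\Gamma\to\mathbb R$ let $H(\mathfrak e,V)=\mathcal F\,\mathfrak e\,\mathcal F^*+V$ on $\ell^2(\Gamma)$, where $\mathfrak e$ and $V$ act as multiplication operators, and let $\mathrm{Thr}(\mathfrak e)=\{\mathfrak e(p):\nabla\mathfrak e(p)=0\}$ be the set of thresholds. Let $A(\mathfrak e)=\mathcal F\hat A\mathcal F^*$ with domain $\mathcal F(C^\infty(\Gamma^*;\mathbb C))$, where $$\hat A f=i\sum_{k=1}^d\Big\{(\partial_{p_k}\mathfrak e)(\partial_{p_k}f)+\tfrac12(\partial_{p_k}^2\mathfrak e)f\Big\},\qquad f\in C^\infty(\Gamma^*;\mathbb C).$$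 **Lemma (Mourre estimate for $H(\mathfrak e,V)$).** Let $\mathfrak e\in C^4(\Gamma^*;\mathbb R)$. Then $A(\mathfrak e)$ is symmetric and essentially self-adjoint: its closure, denoted by $A$, is self-adjoint, and it is the only self-adjoint extension of $A(\mathfrak e)$. For a bounded operator $B$ let $i[B,A]=i(BA-AB)$ on $\{\psi\in\mathrm{Dom}(A): B\psi\in\mathrm{Dom}(A)\}$; densely defined bounded operators are identified with their closures. Let $V$ vanish at infinity, $\lim_{|x|\to\infty}V(x)=0$, and suppose that $i[V,A]$ is (densely defined and bounded, with closure) a compact operator. Then $i[H(\mathfrak e,V),A]$ is densely defined and bounded, and for every continuous, compactly supported $\chi:\mathbb R\to\mathbb R$ with $\mathrm{dist}(\mathrm{Thr}(\mathfrak e),\mathrm{supp}\,\chi)>0$ there are a constant $c_\chi>0$ and a compact operator $K_\chi$ on $\ell^2(\Gamma)$ such that $$\chi[H(\mathfrak e,V)]\; i[H(\mathfrak e,V),A]\;\chi[H(\mathfrak e,V)]\ \ge\ c_\chi\,\chi^2[H(\mathfrak e,V)]+K_\chi .$$ -/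

import Mathlib

open MeasureTheory Filter Topology
open scoped ENNReal ContDiff

noncomputable section

namespace LatticeSchrodinger

/-! ### The lattice, the Brillouin zone and function spaces -/

instance factTwoPiPos : Fact ((0 : ℝ) < 2 * Real.pi) := ⟨Real.two_pi_pos⟩

/-- The lattice `Γ = ℤ^d`. -/
abbrev Lattice (d : ℕ) : Type := Fin d → ℤ

/-- The Brillouin zone `Γ* = (ℝ / 2πℤ)^d`. -/
abbrev Torus (d : ℕ) : Type := Fin d → AddCircle (2 * Real.pi)

/-- The normalized Haar measure `μ*` on the torus. -/
def haarTorus (d : ℕ) : Measure (Torus d) :=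
  Measure.pi fun _ => (AddCircle.haarAddCircle : Measure (AddCircle (2 * Real.pi)))

instance (d : ℕ) : IsProbabilityMeasure (haarTorus d) := by
  unfold haarTorus; infer_instance

instance (d : ℕ) : (haarTorus d).IsOpenPosMeasure := by
  unfold haarTorus; infer_instance

instance (d : ℕ) : (haarTorus d).WeaklyRegular := by
  infer_instance

/-- The Hilbert space `ℓ²(Γ)`. -/
abbrev SeqL2 (d : ℕ) : Type := lp (fun _ : Lattice d => ℂ) 2

/-- The Hilbert space `L²(Γ*)`. -/
abbrev TorusL2 (d : ℕ) : Type := Lp ℂ 2 (haarTorus d)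

/-- The canonical projection `ℝ^d → Γ*`. -/
def proj {d : ℕ} (x : Fin d → ℝ) : Torus d := fun i => (x i : AddCircle (2 * Real.pi))

/-- `f ∈ C^n(Γ*; E)`: the `2π`-periodic function on `ℝ^d` that `f` induces is of class `C^n`. -/
def IsCn {d : ℕ} {E : Type*} [NormedAddCommGroup E] [NormedSpace ℝ E] (n : WithTop ℕ∞)
    (f : Torus d → E) : Prop :=
  ContDiff ℝ n fun x : Fin d → ℝ => f (proj x)

/-- The partial derivative `∂_{p_k} f` of a function on the torus. -/
def partialDeriv {d : ℕ} {E : Type*} [NormedAddCommGroup E] [NormedSpace ℝ E] (k : Fin d)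
    (f : Torus d → E) (p : Torus d) : E :=
  deriv (fun t : ℝ => f (p + Pi.single k (t : AddCircle (2 * Real.pi)))) 0

section Calculus

variable {d : ℕ} {E : Type*} [NormedAddCommGroup E] [NormedSpace ℝ E]

lemma isOpenQuotientMap_proj : IsOpenQuotientMap (proj : (Fin d → ℝ) → Torus d) :=
  IsOpenQuotientMap.piMap (f := fun _ : Fin d => ((↑) : ℝ → AddCircle (2 * Real.pi)))
    fun _ => QuotientAddGroup.isOpenQuotientMap_mk

lemma IsCn.continuous {n : WithTop ℕ∞} {f : Torus d → E} (hf : IsCn n f) : Continuous f :=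
  isOpenQuotientMap_proj.continuous_comp_iff.mp (ContDiff.continuous (n := n) hf)

lemma partialDeriv_proj {f : Torus d → E} (hf : IsCn 1 f) (k : Fin d) (x : Fin d → ℝ) :
    partialDeriv k f (proj x) =
      fderiv ℝ (fun y : Fin d → ℝ => f (proj y)) x (Pi.single k 1) := by
  have h1 : DifferentiableAt ℝ (fun y : Fin d → ℝ => f (proj y)) x :=
    (ContDiff.differentiable (n := 1) hf (by simp)) x
  rw [← h1.lineDeriv_eq_fderiv]
  unfold partialDeriv lineDeriv
  congr 1
  funext t
  congr 1
  funext i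
  by_cases hi : i = k
  · subst hi; simp [proj]
  · simp [proj, hi]

lemma IsCn.partialDeriv {n : WithTop ℕ∞} {f : Torus d → E} (hf : IsCn (n + 1) f) (k : Fin d) :
    IsCn n (partialDeriv k f) := by
  have h1 : IsCn 1 f := ContDiff.of_le (n := n + 1) hf (by simp)
  unfold IsCn
  simp only [partialDeriv_proj h1]
  exact (ContDiff.fderiv_right (n := n + 1) hf le_rfl).clm_apply contDiff_const

lemma differentiableAt_shift {f : Torus d → E} (hf : IsCn 1 f) (k : Fin d) (p : Torus d) :
    DifferentiableAt ℝ
      (fun t : ℝ => f (p + Pi.single k (t : AddCircle (2 * Real.pi)))) 0 := by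
  obtain ⟨x, rfl⟩ := isOpenQuotientMap_proj.surjective p
  have h1 : Differentiable ℝ (fun y : Fin d → ℝ => f (proj y)) :=
    ContDiff.differentiable (n := 1) hf (by simp)
  have h2 : (fun t : ℝ => f (proj x + Pi.single k (t : AddCircle (2 * Real.pi)))) =
      fun t : ℝ => (fun y : Fin d → ℝ => f (proj y)) (x + t • Pi.single k (1 : ℝ)) := by
    funext t
    congr 1
    funext i
    by_cases hi : i = k
    · subst hi; simp [proj]
    · simp [proj, hi]
  rw [h2]
  exact (h1.comp (by fun_prop : Differentiable ℝ
    fun t : ℝ => x + t • (Pi.single k (1 : ℝ) : Fin d → ℝ))) 0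

lemma partialDeriv_add {f g : Torus d → E} (hf : IsCn 1 f) (hg : IsCn 1 g) (k : Fin d)
    (p : Torus d) :
    partialDeriv k (f + g) p = partialDeriv k f p + partialDeriv k g p :=
  deriv_add (differentiableAt_shift hf k p) (differentiableAt_shift hg k p)

lemma partialDeriv_smul {f : Torus d → ℂ} (hf : IsCn 1 f) (c : ℂ) (k : Fin d) (p : Torus d) :
    partialDeriv k (c • f) p = c * partialDeriv k f p :=
  deriv_const_smul c (differentiableAt_shift hf k p)

end Calculus

/-! ### The Fourier transformation -/

/-- The plane wave `p ↦ e^{-i⟨p, x⟩}` on the torus, for a lattice site `x`. -/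
def planeWave {d : ℕ} (x : Lattice d) : C(Torus d, ℂ) where
  toFun p := ∏ k, fourier (-x k) (p k)
  continuous_toFun := by fun_prop

lemma planeWave_proj {d : ℕ} (x : Lattice d) (q : Fin d → ℝ) :
    planeWave x (proj q) = Complex.exp (-Complex.I * ∑ k, (q k : ℂ) * (x k : ℂ)) := by
  simp only [planeWave, ContinuousMap.coe_mk, proj, fourier_coe_apply]
  rw [← Complex.exp_sum, Finset.mul_sum]
  congr 1
  refine Finset.sum_congr rfl fun k _ => ?_
  have : (Real.pi : ℂ) ≠ 0 := by exact_mod_cast Real.pi_ne_zero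
  push_cast
  field_simp

lemma orthonormal_planeWave (d : ℕ) :
    Orthonormal ℂ fun x : Lattice d =>
      ContinuousMap.toLp (E := ℂ) 2 (haarTorus d) ℂ (planeWave x) := by
  rw [orthonormal_iff_ite]
  intro x y
  rw [ContinuousMap.inner_toLp]
  have h1 : ∀ p : Torus d, (planeWave y p) * (starRingEnd ℂ) (planeWave x p) =
      ∏ k, fourier (x k - y k) (p k) := by
    intro p
    simp only [planeWave, ContinuousMap.coe_mk, map_prod, ← fourier_neg, ← Finset.prod_mul_distrib,
      neg_neg, ← fourier_add]
    refine Finset.prod_congr rfl fun k _ => ?_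
    rw [show -y k + x k = x k - y k by ring]
  simp_rw [h1]
  unfold haarTorus
  rw [integral_fintype_prod_eq_prod
    (fun k (q : AddCircle (2 * Real.pi)) => (fourier (x k - y k) q : ℂ))]
  have h2 : ∀ n : ℤ, ∫ q : AddCircle (2 * Real.pi), (fourier n q : ℂ)
      ∂AddCircle.haarAddCircle = if n = 0 then 1 else 0 := by
    intro n
    have h := orthonormal_iff_ite.mp (orthonormal_fourier (T := 2 * Real.pi)) 0 n
    rw [ContinuousMap.inner_toLp] at h
    simpa [eq_comm] using h
  simp_rw [h2, sub_eq_zero]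
  by_cases hxy : x = y
  · simp [hxy]
  · obtain ⟨k, hk⟩ := Function.ne_iff.mp hxy
    rw [if_neg hxy]
    exact Finset.prod_eq_zero (Finset.mem_univ k) (if_neg hk)

lemma span_planeWave_dense (d : ℕ) :
    (Submodule.span ℂ (Set.range (planeWave (d := d)))).topologicalClosure = ⊤ := by
  let φ : Torus d ≃ₜ UnitAddTorus (Fin d) := Homeomorph.piCongrRight fun _ =>
    AddCircle.homeomorphAddCircle (2 * Real.pi) 1 Real.two_pi_pos.ne' one_ne_zero
  let Φ : C(UnitAddTorus (Fin d), ℂ) →L[ℂ] C(Torus d, ℂ) :=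
    { toFun := fun f => f.comp (φ : C(Torus d, UnitAddTorus (Fin d)))
      map_add' := fun _ _ => rfl
      map_smul' := fun _ _ => rfl
      cont := ContinuousMap.continuous_precomp _ }
  have hΦ : DenseRange Φ := Function.Surjective.denseRange fun f =>
    ⟨f.comp (φ.symm : C(UnitAddTorus (Fin d), Torus d)), by ext p; simp [Φ]⟩
  have h := hΦ.topologicalClosure_map_submodule
    (UnitAddTorus.span_mFourier_closure_eq_top (d := Fin d))
  rw [Submodule.map_span, ← Set.range_comp] at h
  have hΦn : ∀ n : Fin d → ℤ, Φ (UnitAddTorus.mFourier n) = planeWave (-n) := by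
    intro n
    ext p
    obtain ⟨q, rfl⟩ := isOpenQuotientMap_proj.surjective p
    simp only [planeWave, UnitAddTorus.mFourier, Φ, φ, ContinuousLinearMap.coe_mk', LinearMap.coe_mk,
      AddHom.coe_mk, ContinuousMap.comp_apply, ContinuousMap.coe_mk, Pi.neg_apply, neg_neg]
    refine Finset.prod_congr rfl fun k _ => ?_
    simp only [proj, Homeomorph.piCongrRight_apply,
      AddCircle.homeomorphAddCircle_apply_mk, fourier_coe_apply]
    congr 1
    have : (Real.pi : ℂ) ≠ 0 := by exact_mod_cast Real.pi_ne_zero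
    push_cast
    field_simp
  convert! h using 3
  ext f
  constructor
  · rintro ⟨x, rfl⟩
    exact ⟨-x, by simp [hΦn]⟩
  · rintro ⟨n, rfl⟩
    exact ⟨-n, by simp [hΦn]⟩

lemma span_planeWaveLp_dense (d : ℕ) :
    (Submodule.span ℂ (Set.range fun x : Lattice d =>
      ContinuousMap.toLp (E := ℂ) 2 (haarTorus d) ℂ (planeWave x))).topologicalClosure = ⊤ := by
  simpa only [Submodule.map_span, ContinuousLinearMap.coe_coe, ← Set.range_comp,
    Function.comp_def] using
    (ContinuousMap.toLp_denseRange ℂ (haarTorus d) ℂ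
      (by simp : (2 : ℝ≥0∞) ≠ ⊤)).topologicalClosure_map_submodule (span_planeWave_dense d)

/-- The plane waves form a Hilbert basis of `L²(Γ*)`. -/
def planeWaveBasis (d : ℕ) : HilbertBasis (Lattice d) ℂ (TorusL2 d) :=
  HilbertBasis.mk (orthonormal_planeWave d) (span_planeWaveLp_dense d).ge

/-- The unitary (inverse) Fourier transformation `F : L²(Γ*) → ℓ²(Γ)`; its inverse `F.symm` is the
discrete Fourier transformation `F* : ℓ²(Γ) → L²(Γ*)`. -/
def fourierF (d : ℕ) : TorusL2 d ≃ₗᵢ[ℂ] SeqL2 d := (planeWaveBasis d).repr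

/-- `[F f](x) = ∫ e^{i⟨p, x⟩} f(p) dμ*(p)`. -/
lemma fourierF_apply {d : ℕ} (f : TorusL2 d) (x : Lattice d) :
    fourierF d f x = ∫ p, (starRingEnd ℂ) (planeWave x p) * f p ∂(haarTorus d) := by
  unfold fourierF
  rw [(planeWaveBasis d).repr_apply_apply f x, L2.inner_def, planeWaveBasis, HilbertBasis.coe_mk]
  refine integral_congr_ae ?_
  filter_upwards [ContinuousMap.coeFn_toLp (p := 2) (𝕜 := ℂ) (haarTorus d) (planeWave x)]
    with p hp
  rw [hp, RCLike.inner_apply, mul_comm]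

/-- `F* ψ = ∑_x ψ(x) e^{-i⟨·, x⟩}`, with convergence in `L²(Γ*)`. -/
lemma hasSum_fourierF_symm {d : ℕ} (ψ : SeqL2 d) :
    HasSum (fun x : Lattice d =>
      ψ x • ContinuousMap.toLp (E := ℂ) 2 (haarTorus d) ℂ (planeWave x)) ((fourierF d).symm ψ) := by
  have h := (planeWaveBasis d).hasSum_repr_symm ψ
  have hb : ⇑(planeWaveBasis d) = fun x : Lattice d =>
      ContinuousMap.toLp (E := ℂ) 2 (haarTorus d) ℂ (planeWave x) := HilbertBasis.coe_mk _ _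
  rw [hb] at h
  exact h

/-! ### The Schrödinger operator -/

/-- A dispersion relation: a real-valued `C²` function on the torus `Γ*`. -/
structure Dispersion (d : ℕ) where
  /-- The underlying function. -/
  toFun : Torus d → ℝ
  isC2 : IsCn 2 toFun

instance (d : ℕ) : CoeFun (Dispersion d) fun _ => Torus d → ℝ := ⟨Dispersion.toFun⟩

/-- The dispersion relation as a continuous complex-valued function. -/
def Dispersion.toC {d : ℕ} (e : Dispersion d) : C(Torus d, ℂ) :=
  ⟨fun p => (e p : ℂ), Complex.continuous_ofReal.comp e.isC2.continuous⟩

/-- Multiplication by a continuous function, as a bounded operator on `L²(Γ*)`. -/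
def mulOp {d : ℕ} (m : C(Torus d, ℂ)) : TorusL2 d →L[ℂ] TorusL2 d :=
  (ContinuousLinearMap.mul ℂ ℂ).holderL (haarTorus d) ⊤ 2 2
    (ContinuousMap.toLp (E := ℂ) ⊤ (haarTorus d) ℂ m)

lemma mulOp_ae {d : ℕ} (m : C(Torus d, ℂ)) (f : TorusL2 d) :
    mulOp m f =ᵐ[haarTorus d] fun p => m p * f p := by
  unfold mulOp
  rw [ContinuousLinearMap.holderL_apply_apply]
  filter_upwards [(ContinuousLinearMap.mul ℂ ℂ).coeFn_holder (r := 2)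
      (ContinuousMap.toLp (E := ℂ) ⊤ (haarTorus d) ℂ m) f,
    ContinuousMap.coeFn_toLp (p := ⊤) (𝕜 := ℂ) (haarTorus d) m] with p h1 h2
  rw [h1, h2, ContinuousLinearMap.mul_apply']

/-- The hopping matrix `h(e) = F e F*` on `ℓ²(Γ)`. -/
def hopping {d : ℕ} (e : Dispersion d) : SeqL2 d →L[ℂ] SeqL2 d :=
  ((fourierF d).toContinuousLinearEquiv : TorusL2 d →L[ℂ] SeqL2 d) ∘L
    mulOp e.toC ∘L ((fourierF d).symm.toContinuousLinearEquiv : SeqL2 d →L[ℂ] TorusL2 d)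

/-- Multiplication by the bounded real potential `V`, as a bounded operator on `ℓ²(Γ)`. -/
def potentialOp {d : ℕ} (V : lp (fun _ : Lattice d => ℝ) ∞) : SeqL2 d →L[ℂ] SeqL2 d :=
  lp.mapCLM 2 (fun x => (V x : ℂ) • ContinuousLinearMap.id ℂ ℂ) (K := ‖V‖) (norm_nonneg V)
    fun x => by
      have h := lp.norm_apply_le_norm (by simp) V x
      simpa [norm_smul] using h

lemma potentialOp_apply {d : ℕ} (V : lp (fun _ : Lattice d => ℝ) ∞) (ψ : SeqL2 d)
    (x : Lattice d) : potentialOp V ψ x = (V x : ℂ) * ψ x := by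
  simp [potentialOp]

/-- The discrete Schrödinger operator `H(e, V) = h(e) + V` on `ℓ²(Γ)`. -/
def hamiltonian {d : ℕ} (e : Dispersion d) (V : lp (fun _ : Lattice d => ℝ) ∞) :
    SeqL2 d →L[ℂ] SeqL2 d :=
  hopping e + potentialOp V

/-- The operator `χ(T)` given by the continuous functional calculus of a bounded self-adjoint operator
`T` on a Hilbert space. -/
def functionOf {E : Type*} [NormedAddCommGroup E] [InnerProductSpace ℂ E] [CompleteSpace E]
    (χ : ℝ → ℝ) (T : E →L[ℂ] E) : E →L[ℂ] E :=
  cfc χ T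

lemma isSelfAdjoint_hamiltonian {d : ℕ} (e : Dispersion d)
    (V : lp (fun _ : Lattice d => ℝ) ∞) : IsSelfAdjoint (hamiltonian e V) := by
  rw [ContinuousLinearMap.isSelfAdjoint_iff_isSymmetric]
  have hm : ∀ f g : TorusL2 d, inner ℂ (mulOp e.toC f) g = inner ℂ f (mulOp e.toC g) := by
    intro f g
    rw [L2.inner_def, L2.inner_def]
    refine integral_congr_ae ?_
    filter_upwards [mulOp_ae e.toC f, mulOp_ae e.toC g] with p h1 h2
    rw [h1, h2]
    simp only [RCLike.inner_apply, map_mul, Dispersion.toC, ContinuousMap.coe_mk,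
      Complex.conj_ofReal]
    ring
  intro φ ψ
  change inner ℂ (hopping e φ + potentialOp V φ) ψ = inner ℂ φ (hopping e ψ + potentialOp V ψ)
  rw [inner_add_left, inner_add_right]
  congr 1
  · change inner ℂ (fourierF d (mulOp e.toC ((fourierF d).symm φ))) ψ =
      inner ℂ φ (fourierF d (mulOp e.toC ((fourierF d).symm ψ)))
    rw [LinearIsometryEquiv.inner_map_eq_flip, hm, LinearIsometryEquiv.inner_map_eq_flip,
      LinearIsometryEquiv.symm_symm]
  · rw [lp.inner_eq_tsum, lp.inner_eq_tsum]
    refine tsum_congr fun x => ?_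
    rw [potentialOp_apply, potentialOp_apply]
    simp only [RCLike.inner_apply, map_mul, Complex.conj_ofReal]
    ring

/-- The set `Crit(e)` of critical points of the dispersion relation. -/
def crit {d : ℕ} (e : Dispersion d) : Set (Torus d) := {p | ∀ k, partialDeriv k e.toFun p = 0}

/-- The set `Thr(e) = e(Crit(e))` of thresholds. -/
def thresholds {d : ℕ} (e : Dispersion d) : Set ℝ := e '' crit e

/-! ### The conjugate operator -/

/-- The space `C^∞(Γ*; ℂ)`. -/
def smoothFunctions (d : ℕ) : Submodule ℂ C(Torus d, ℂ) where
  carrier := {f | IsCn ∞ (f : Torus d → ℂ)}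
  add_mem' hf hg := ContDiff.add (n := ∞) hf hg
  zero_mem' := (contDiff_const : ContDiff ℝ ∞ fun _ : Fin d → ℝ => (0 : ℂ))
  smul_mem' c _ hf := ContDiff.const_smul (n := ∞) c hf

lemma smoothFunctions.isC1 {d : ℕ} (f : smoothFunctions d) :
    IsCn 1 (f : C(Torus d, ℂ)) := ContDiff.of_le (n := ∞) f.2 (by simp)

/-- The embedding `C^∞(Γ*; ℂ) ⊂ L²(Γ*)`. -/
def smoothToL2 (d : ℕ) : smoothFunctions d →ₗ[ℂ] TorusL2 d :=
  (ContinuousMap.toLp (E := ℂ) 2 (haarTorus d) ℂ).toLinearMap ∘ₗ (smoothFunctions d).subtype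

lemma smoothToL2_injective (d : ℕ) : Function.Injective (smoothToL2 d) :=
  (ContinuousMap.toLp_injective (haarTorus d)).comp Subtype.val_injective

/-- The first-order differential expression
`f ↦ i ∑_k { (∂_k e) (∂_k f) + ½ (∂_k² e) f }` on `C^∞(Γ*; ℂ)`. -/
def diffExpr {d : ℕ} (e : Dispersion d) : smoothFunctions d →ₗ[ℂ] C(Torus d, ℂ) where
  toFun f :=
    { toFun := fun p => Complex.I * ∑ k : Fin d,
        (((partialDeriv k e.toFun p : ℝ) : ℂ) * partialDeriv k (f : C(Torus d, ℂ)) p +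
          1 / 2 * ((partialDeriv k (partialDeriv k e.toFun) p : ℝ) : ℂ) * (f : C(Torus d, ℂ)) p)
      continuous_toFun := by
        have h1 : ∀ k, Continuous (partialDeriv k e.toFun) := fun k =>
          (IsCn.partialDeriv (n := 1) e.isC2 k).continuous
        have h2 : ∀ k, Continuous (partialDeriv k (partialDeriv k e.toFun)) := fun k =>
          (IsCn.partialDeriv (n := 0) (IsCn.partialDeriv (n := 1) e.isC2 k) k).continuous
        have h3 : ∀ k, Continuous (partialDeriv k (f : C(Torus d, ℂ))) := fun k =>
          (IsCn.partialDeriv (n := 0) (smoothFunctions.isC1 f) k).continuous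
        fun_prop }
  map_add' f g := by
    ext p
    simp only [Submodule.coe_add, ContinuousMap.coe_add, ContinuousMap.coe_mk,
      ContinuousMap.add_apply,
      partialDeriv_add (smoothFunctions.isC1 f) (smoothFunctions.isC1 g)]
    rw [← mul_add, ← Finset.sum_add_distrib]
    congr 1
    refine Finset.sum_congr rfl fun k _ => ?_
    ring
  map_smul' c f := by
    ext p
    simp only [Submodule.coe_smul, ContinuousMap.coe_smul, ContinuousMap.coe_mk,
      ContinuousMap.smul_apply, smul_eq_mul, RingHom.id_apply,
      partialDeriv_smul (smoothFunctions.isC1 f)]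
    simp only [Finset.mul_sum]
    refine Finset.sum_congr rfl fun k _ => ?_
    ring

/-- The operator `Â(e)` in `L²(Γ*)`, with domain `C^∞(Γ*; ℂ)`. -/
def conjugateHat {d : ℕ} (e : Dispersion d) : TorusL2 d →ₗ.[ℂ] TorusL2 d where
  domain := LinearMap.range (smoothToL2 d)
  toFun := (ContinuousMap.toLp (E := ℂ) 2 (haarTorus d) ℂ).toLinearMap ∘ₗ diffExpr e ∘ₗ
    (LinearEquiv.ofInjective (smoothToL2 d) (smoothToL2_injective d)).symm.toLinearMap

/-- The operator `A(e) = F Â(e) F*` in `ℓ²(Γ)`, with domain `F(C^∞(Γ*; ℂ))`. -/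
def conjugateOp {d : ℕ} (e : Dispersion d) : SeqL2 d →ₗ.[ℂ] SeqL2 d where
  domain := (conjugateHat e).domain.comap (fourierF d).symm.toLinearEquiv.toLinearMap
  toFun :=
    { toFun := fun ψ => fourierF d (conjugateHat e ⟨(fourierF d).symm ψ, ψ.2⟩)
      map_add' := fun φ ψ => by
        rw [← map_add, ← LinearPMap.map_add]
        congr 2
        exact Subtype.ext (map_add (fourierF d).symm (φ : SeqL2 d) (ψ : SeqL2 d))
      map_smul' := fun c ψ => by
        rw [RingHom.id_apply, ← map_smul, ← LinearPMap.map_smul]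
        congr 2
        exact Subtype.ext (map_smul (fourierF d).symm c (ψ : SeqL2 d)) }

/-! ### Commutators -/

/-- The operator `i[B, A] = i(BA - AB)` on its natural domain
`{ψ ∈ Dom(A) | Bψ ∈ Dom(A)}`, for `B` bounded and `A` possibly unbounded. -/
def iCommutator {E : Type*} [NormedAddCommGroup E] [InnerProductSpace ℂ E] (B : E →L[ℂ] E)
    (A : E →ₗ.[ℂ] E) : E →ₗ.[ℂ] E where
  domain := A.domain ⊓ A.domain.comap B.toLinearMap
  toFun :=
    { toFun := fun ψ => Complex.I • (B (A ⟨ψ, ψ.2.1⟩) - A ⟨B ψ, ψ.2.2⟩)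
      map_add' := fun φ ψ => by
        rw [← smul_add]
        congr 1
        have h1 : A ⟨((φ + ψ : _) : E), (φ + ψ).2.1⟩ = A ⟨φ, φ.2.1⟩ + A ⟨ψ, ψ.2.1⟩ := by
          rw [← LinearPMap.map_add]; rfl
        have h2 : A ⟨B ((φ + ψ : _) : E), (φ + ψ).2.2⟩ = A ⟨B φ, φ.2.2⟩ + A ⟨B ψ, ψ.2.2⟩ := by
          rw [← LinearPMap.map_add]
          congr 1
          exact Subtype.ext (map_add B (φ : E) (ψ : E))
        rw [h1, h2, map_add]
        abel
      map_smul' := fun c ψ => by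
        rw [RingHom.id_apply, smul_comm c]
        congr 1
        have h1 : A ⟨((c • ψ : _) : E), (c • ψ).2.1⟩ = c • A ⟨ψ, ψ.2.1⟩ := by
          rw [← LinearPMap.map_smul]; rfl
        have h2 : A ⟨B ((c • ψ : _) : E), (c • ψ).2.2⟩ = c • A ⟨B ψ, ψ.2.2⟩ := by
          rw [← LinearPMap.map_smul]
          congr 1
          exact Subtype.ext (map_smul B c (ψ : E))
        rw [h1, h2, map_smul, smul_sub] }

/-- The operator `T` is densely defined and bounded, and the everywhere defined bounded operator `C`
is its closure, i.e. its unique bounded extension. -/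
def HasBoundedClosure {E : Type*} [NormedAddCommGroup E] [InnerProductSpace ℂ E]
    (T : E →ₗ.[ℂ] E) (C : E →L[ℂ] E) : Prop :=
  Dense (T.domain : Set E) ∧ T ≤ C.toLinearMap.toPMap ⊤

end LatticeSchrodinger

end

open LatticeSchrodinger

/-! On the Fourier side `A(e)` is the symmetrized vector field `i(∇e·∇ + ½Δe)`. Integration by parts
makes it symmetric, the zero-order term absorbing the derivatives that fall on `∇e`. Essential
self-adjointness is Nelson's commutator argument with comparison operator `N = 1 - Δ`: the vector
field is bounded relative to `N^{1/2}`, and its commutator with `N` is form-bounded by `N` because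
commuting with `∂_j` only differentiates the coefficients (`exists_abs_im_inner_firstOrder_le`).
Hence the deficiency spaces at `±iκ` vanish for large `κ` (`exists_deficiency_bound`), and
`IsFormalAdjoint.isSelfAdjoint_closure` concludes.

By the Leibniz rule (`firstOrder_mul`), `i[h(e), A]` is multiplication by `|∇e|²` in momentum space.
It is bounded, and on the support of `χ ∘ e`, which stays away from the critical points of `e`,
compactness of the torus gives `|∇e|² ≥ c > 0`.

The potential enters only through compact errors. As `V` vanishes at infinity it is compact, and so
is `χ(H) - χ(h(e))`, by polynomial approximation (`isCompactOperator_functionOf_sub`). Modulo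
compact operators the Mourre estimate thus reduces to the pointwise inequality `χ(e)²(|∇e|² - c) ≥
0` on the torus. -/

namespace LinearPMap

/-! ### Closures, adjoints and self-adjointness of symmetric operators. -/

variable {H : Type*} [NormedAddCommGroup H] [InnerProductSpace ℂ H]

/-- The closure is the smallest closed extension. -/
lemma closure_le_of_isClosed {S T : H →ₗ.[ℂ] H} (hT : T.IsClosed) (h : S ≤ T) :
    S.closure ≤ T := by
  refine le_of_le_graph ?_
  rw [← (hT.isClosable.leIsClosable h).graph_closure_eq_closure_graph]
  exact Submodule.topologicalClosure_minimal _ (le_graph_of_le h) hT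

/-- If `(a, b) ↦ (B a, B b + M a)` maps the graph of `T` into the graph of its closure, then it
preserves the graph of the closure. -/
lemma IsClosable.mem_graph_closure_of_forall {T : H →ₗ.[ℂ] H} (hT : T.IsClosable)
    (B M : H →L[ℂ] H)
    (h : ∀ a b, (a, b) ∈ T.graph → (B a, B b + M a) ∈ T.closure.graph) {a b : H}
    (hab : (a, b) ∈ T.closure.graph) : (B a, B b + M a) ∈ T.closure.graph := by
  have hcl : _root_.IsClosed (T.closure.graph : Set (H × H)) := hT.closure_isClosed
  have hΦ : Continuous fun z : H × H => (B z.1, B z.2 + M z.1) := by fun_prop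
  rw [← hT.graph_closure_eq_closure_graph] at hab
  exact closure_minimal (fun z hz => h z.1 z.2 hz) (hcl.preimage hΦ) hab

/-- A symmetric operator satisfies `‖Tf - iκf‖² = ‖Tf‖² + κ²‖f‖²`. -/
lemma IsFormalAdjoint.norm_sub_sq {T : H →ₗ.[ℂ] H} (h : T.IsFormalAdjoint T) (κ : ℝ)
    (f : T.domain) :
    ‖T f - ((κ : ℂ) * Complex.I) • (f : H)‖ ^ 2 = ‖T f‖ ^ 2 + κ ^ 2 * ‖(f : H)‖ ^ 2 := by
  have hreal : (inner ℂ (T f) (f : H)).im = 0 := by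
    have h1 : inner ℂ (T f) (f : H) = (starRingEnd ℂ) (inner ℂ (T f) (f : H)) := by
      rw [inner_conj_symm]; exact h f f
    exact Complex.conj_eq_iff_im.mp h1.symm
  rw [_root_.norm_sub_sq (𝕜 := ℂ), inner_smul_right, norm_smul]
  simp [hreal, mul_pow]

variable [CompleteSpace H]

/-- A densely defined symmetric operator is closable, and its adjoint extends its closure. -/
lemma IsFormalAdjoint.closable_and_closure_le {T : H →ₗ.[ℂ] H} (hT : Dense (T.domain : Set H))
    (h : T.IsFormalAdjoint T) : T.IsClosable ∧ T.closure ≤ T.adjoint := by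
  have hle : T ≤ T.adjoint := h.le_adjoint hT
  have hcl : T.IsClosable := (adjoint_isClosed hT).isClosable.leIsClosable hle
  exact ⟨hcl, closure_le_of_isClosed (adjoint_isClosed hT) hle⟩

/-- The adjoint is order reversing on densely defined operators. -/
lemma adjoint_anti {S T : H →ₗ.[ℂ] H} (hS : Dense (S.domain : Set H)) (h : S ≤ T) :
    T.adjoint ≤ S.adjoint := by
  have hT : Dense (T.domain : Set H) := hS.mono h.1
  refine IsFormalAdjoint.le_adjoint hS fun x y => ?_
  have h1 := adjoint_isFormalAdjoint hT y ⟨x, h.1 x.2⟩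
  rw [h.2 (x := x) (y := ⟨x, h.1 x.2⟩) rfl]
  rw [← inner_conj_symm, ← h1, inner_conj_symm]

/-- A densely defined symmetric operator `T` with vanishing deficiency spaces `(ran (T ∓ iκ))ᗮ`
is essentially self-adjoint. -/
lemma IsFormalAdjoint.isSelfAdjoint_closure {T : H →ₗ.[ℂ] H} (hT : Dense (T.domain : Set H))
    (h : T.IsFormalAdjoint T) {κ : ℝ} (hκ : κ ≠ 0)
    (hpos : ∀ ψ : H, (∀ f : T.domain, inner ℂ ψ (T f - ((κ : ℂ) * Complex.I) • (f : H)) = 0) →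
      ψ = 0)
    (hneg : ∀ ψ : H, (∀ f : T.domain, inner ℂ ψ (T f - (((-κ : ℝ) : ℂ) * Complex.I) • (f : H)) = 0)
      → ψ = 0) :
    IsSelfAdjoint T.closure := by
  obtain ⟨hcl, hle⟩ := h.closable_and_closure_le hT
  have hdc : Dense (T.closure.domain : Set H) := hT.mono (le_closure T).1
  -- the range of `T.closure - iκ` is everything
  have hsurj : ∀ w : H, ∃ u : T.closure.domain,
      T.closure u - ((κ : ℂ) * Complex.I) • (u : H) = w := by
    intro w
    let R : T.domain →ₗ[ℂ] H := T.toFun - ((κ : ℂ) * Complex.I) • T.domain.subtype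
    have hR : ∀ f : T.domain, R f = T f - ((κ : ℂ) * Complex.I) • (f : H) := fun f => rfl
    have hdense : Dense ((LinearMap.range R : Submodule ℂ H) : Set H) := by
      rw [Submodule.dense_iff_topologicalClosure_eq_top,
        Submodule.topologicalClosure_eq_top_iff, Submodule.eq_bot_iff]
      intro ψ hψ
      refine hpos ψ fun f => ?_
      rw [← hR]
      exact (Submodule.mem_orthogonal' _ _).mp hψ _ ⟨f, rfl⟩
    obtain ⟨s, hs, hsw⟩ := mem_closure_iff_seq_limit.mp (hdense w)
    choose f hf using hs
    have hcs : CauchySeq s := hsw.cauchySeq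
    -- By `norm_sub_sq`, `T - iκ` controls both `T g` and `g`; a convergent sequence in its range
    -- therefore comes from a sequence that is Cauchy in graph norm.
    have hnorm : ∀ g : T.domain, ‖T g‖ ≤ ‖R g‖ ∧ |κ| * ‖(g : H)‖ ≤ ‖R g‖ := by
      intro g
      have h1 := h.norm_sub_sq κ g
      rw [← hR] at h1
      constructor
      · refine abs_le_of_sq_le_sq' ?_ (norm_nonneg _) |>.2
        rw [h1]; nlinarith [sq_nonneg (κ * ‖(g : H)‖)]
      · refine abs_le_of_sq_le_sq' ?_ (norm_nonneg _) |>.2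
        rw [h1, mul_pow, sq_abs]; nlinarith [sq_nonneg ‖T g‖]
    have hsub : ∀ m n, R (f m - f n) = s m - s n := fun m n => by rw [_root_.map_sub, hf, hf]
    have hκ' : 0 < |κ| := abs_pos.mpr hκ
    have hTf : CauchySeq fun n => T (f n) := by
      rw [Metric.cauchySeq_iff] at hcs ⊢
      intro ε hε
      obtain ⟨N, hN⟩ := hcs ε hε
      refine ⟨N, fun m hm n hn => lt_of_le_of_lt ?_ (hN m hm n hn)⟩
      rw [dist_eq_norm, dist_eq_norm, ← hsub, ← LinearPMap.map_sub]
      exact (hnorm _).1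
    have hff : CauchySeq fun n => (f n : H) := by
      rw [Metric.cauchySeq_iff] at hcs ⊢
      intro ε hε
      obtain ⟨N, hN⟩ := hcs (|κ| * ε) (by positivity)
      refine ⟨N, fun m hm n hn => lt_of_mul_lt_mul_left (lt_of_le_of_lt ?_ (hN m hm n hn)) hκ'.le⟩
      rw [dist_eq_norm, dist_eq_norm, ← hsub]
      exact (hnorm (f m - f n)).2
    obtain ⟨u, hu⟩ := cauchySeq_tendsto_of_complete hff
    obtain ⟨v, hv⟩ := cauchySeq_tendsto_of_complete hTf
    have hmem : (u, v) ∈ T.closure.graph := by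
      rw [← hcl.graph_closure_eq_closure_graph]
      exact mem_closure_of_tendsto (hu.prodMk_nhds hv)
        (Eventually.of_forall fun n => T.mem_graph (f n))
    obtain ⟨y, hy1, hy2⟩ := (mem_graph_iff _).mp hmem
    refine ⟨y, ?_⟩
    rw [hy1, hy2]
    refine tendsto_nhds_unique ?_ hsw
    have h3 : s = fun n => T (f n) - ((κ : ℂ) * Complex.I) • (f n : H) := by
      funext n; rw [← hf, hR]
    rw [h3]
    exact hv.sub (hu.const_smul _)
  have hsymm : T.closure.adjoint = T.adjoint := by
    refine le_antisymm (adjoint_anti hT (le_closure T)) ?_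
    refine IsFormalAdjoint.le_adjoint hdc fun x y => ?_
    -- the pairing identity passes to the closure of the graph
    let G : Set (H × H) := {p | inner ℂ p.2 (y : H) = inner ℂ p.1 (T.adjoint y)}
    have hG : _root_.IsClosed G := _root_.isClosed_eq (by fun_prop) (by fun_prop)
    have hTG : (T.graph : Set (H × H)) ⊆ G := by
      rintro ⟨a, b⟩ hab
      obtain ⟨z, rfl, rfl⟩ := (mem_graph_iff _).mp hab
      exact (adjoint_isFormalAdjoint hT).symm z y
    have hx : ((x : H), T.closure x) ∈ (T.graph.topologicalClosure : Set (H × H)) := by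
      rw [hcl.graph_closure_eq_closure_graph]; exact mem_graph _ x
    exact closure_minimal hTG hG hx
  rw [isSelfAdjoint_def, hsymm]
  refine le_antisymm ?_ hle
  refine le_of_le_graph ?_
  rintro ⟨a, b⟩ hab
  obtain ⟨x, rfl, rfl⟩ := (mem_graph_iff _).mp hab
  -- For `x` in the domain of the adjoint, solve `(closure - iκ)u = (T* - iκ)x`. Then `T*(u - x) =
  -- iκ(u - x)`, so `u - x` is orthogonal to the range of `T + iκ` and vanishes by `hneg`. Hence `x
  -- = u` lies in the domain of the closure.
  obtain ⟨u, hu⟩ := hsurj (T.adjoint x - ((κ : ℂ) * Complex.I) • (x : H))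
  let u' : T.adjoint.domain := ⟨u, hle.1 u.2⟩
  have hu' : T.closure u = T.adjoint u' := hle.2 (x := u) (y := u') rfl
  have hzero : (u : H) - x = 0 := by
    refine hneg _ fun f => ?_
    have h1 := adjoint_isFormalAdjoint hT (u' - x) f
    have h2 : T.adjoint (u' - x) = ((κ : ℂ) * Complex.I) • ((u : H) - x) := by
      rw [LinearPMap.map_sub, ← hu', smul_sub, sub_eq_sub_iff_sub_eq_sub]
      exact hu
    have h3 : ((u' - x : T.adjoint.domain) : H) = (u : H) - x := rfl
    rw [h2, h3] at h1
    rw [inner_sub_right, ← h1, inner_smul_left, inner_smul_right]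
    simp
  have hux : (u : H) = x := sub_eq_zero.mp hzero
  have hux' : u' = x := Subtype.ext hux
  rw [← hux', ← hu']
  exact mem_graph _ u

/-- A self-adjoint operator extending `T` equals the closure of `T`, if the latter is
self-adjoint. -/
lemma eq_closure_of_isSelfAdjoint {T B : H →ₗ.[ℂ] H} (hT : IsSelfAdjoint T.closure)
    (hB : IsSelfAdjoint B) (h : T ≤ B) : B = T.closure := by
  have hle : T.closure ≤ B := closure_le_of_isClosed hB.isClosed h
  refine le_antisymm ?_ hle
  -- Self-adjoint operators are maximal: taking adjoints reverses the inclusion of the closure in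
  -- `B`.
  have h2 := adjoint_anti hT.dense_domain hle
  rwa [isSelfAdjoint_def.mp hB, isSelfAdjoint_def.mp hT] at h2

end LinearPMap

/-! ### Closure properties of `C^n` functions on the torus. -/

noncomputable section

namespace LatticeSchrodinger

variable {d : ℕ}

instance : (haarTorus d).IsAddLeftInvariant := by
  unfold haarTorus; infer_instance

lemma IsCn.of_le {n m : WithTop ℕ∞} {f : Torus d → ℂ} (hf : IsCn n f) (h : m ≤ n) : IsCn m f :=
  ContDiff.of_le (n := n) hf h

lemma IsCn.add {n : WithTop ℕ∞} {f g : Torus d → ℂ} (hf : IsCn n f) (hg : IsCn n g) :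
    IsCn n (f + g) :=
  ContDiff.add (n := n) hf hg

lemma IsCn.mul {n : WithTop ℕ∞} {f g : Torus d → ℂ} (hf : IsCn n f) (hg : IsCn n g) :
    IsCn n (f * g) :=
  ContDiff.mul (n := n) hf hg

lemma IsCn.const_smul {n : WithTop ℕ∞} {f : Torus d → ℂ} (c : ℂ) (hf : IsCn n f) :
    IsCn n (c • f) :=
  ContDiff.const_smul (n := n) c hf

lemma IsCn.star {n : WithTop ℕ∞} {f : Torus d → ℂ} (hf : IsCn n f) : IsCn n (star f) :=
  Complex.conjCLE.contDiff.comp (g := Complex.conjCLE) (show ContDiff ℝ n _ from hf)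

lemma IsCn.sum {n : WithTop ℕ∞} {ι : Type*} {s : Finset ι} {f : ι → Torus d → ℂ}
    (hf : ∀ i ∈ s, IsCn n (f i)) : IsCn n (∑ i ∈ s, f i) := by
  unfold IsCn
  simp only [Finset.sum_apply]
  exact ContDiff.sum fun i hi => hf i hi

lemma isCn_planeWave (n : WithTop ℕ∞) (x : Lattice d) : IsCn n (planeWave x) := by
  unfold IsCn
  simp only [planeWave_proj]
  have h : ∀ k, ContDiff ℝ n fun q : Fin d → ℝ => (q k : ℂ) := fun k =>
    Complex.ofRealCLM.contDiff.comp (contDiff_apply ℝ ℝ k)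
  exact (contDiff_const.mul (ContDiff.sum fun k _ => (h k).mul contDiff_const)).cexp

lemma IsCn.ofReal {n : WithTop ℕ∞} {f : Torus d → ℝ} (hf : IsCn n f) :
    IsCn n fun p => (f p : ℂ) :=
  Complex.ofRealCLM.contDiff.comp (g := Complex.ofRealCLM) (show ContDiff ℝ n _ from hf)

/-! ### Partial derivatives as continuous functions -/

open Classical in
/-- The partial derivative `∂_k f` of a `C¹` function, as a continuous function. -/
def pderiv (k : Fin d) (f : C(Torus d, ℂ)) : C(Torus d, ℂ) :=
  if h : IsCn 1 f then ⟨partialDeriv k f, (IsCn.partialDeriv (n := 0) h k).continuous⟩ else 0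

lemma coe_pderiv {f : C(Torus d, ℂ)} (hf : IsCn 1 f) (k : Fin d) :
    ⇑(pderiv k f) = partialDeriv k f := by
  simp [pderiv, hf]

lemma pderiv_apply {f : C(Torus d, ℂ)} (hf : IsCn 1 f) (k : Fin d) (p : Torus d) :
    pderiv k f p = partialDeriv k f p := by
  rw [coe_pderiv hf]

lemma IsCn.pderiv {n : WithTop ℕ∞} {f : C(Torus d, ℂ)} (hf : IsCn (n + 1) f) (k : Fin d) :
    IsCn n (pderiv k f) := by
  rw [coe_pderiv (hf.of_le (by simp))]
  exact IsCn.partialDeriv hf k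

/-- `partialDeriv` only speaks of the derivative at `t = 0`; translation along the `k`-th circle
moves it to every `t`, as differentiation under the integral requires. -/
lemma hasDerivAt_shift {f : C(Torus d, ℂ)} (hf : IsCn 1 f) (k : Fin d) (p : Torus d) (t : ℝ) :
    HasDerivAt (fun s : ℝ => f (p + Pi.single k (s : AddCircle (2 * Real.pi))))
      (pderiv k f (p + Pi.single k (t : AddCircle (2 * Real.pi)))) t := by
  have h := (differentiableAt_shift hf k
    (p + Pi.single k (t : AddCircle (2 * Real.pi)))).hasDerivAt
  rw [← sub_self t] at h
  have h2 := h.comp_sub_const t t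
  rw [pderiv_apply hf]
  unfold LatticeSchrodinger.partialDeriv
  rw [sub_self] at h2
  convert! h2 using 1
  funext s
  congr 1
  rw [add_assoc, ← Pi.single_add, ← AddCircle.coe_add, add_sub_cancel]

lemma pderiv_add {f g : C(Torus d, ℂ)} (hf : IsCn 1 f) (hg : IsCn 1 g) (k : Fin d) :
    pderiv k (f + g) = pderiv k f + pderiv k g := by
  ext p
  rw [ContinuousMap.add_apply, pderiv_apply hf, pderiv_apply hg,
    pderiv_apply (f := f + g) (hf.add hg)]
  exact partialDeriv_add hf hg k p

lemma pderiv_smul {f : C(Torus d, ℂ)} (hf : IsCn 1 f) (c : ℂ) (k : Fin d) :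
    pderiv k (c • f) = c • pderiv k f := by
  ext p
  rw [ContinuousMap.smul_apply, pderiv_apply hf, pderiv_apply (f := c • f) (hf.const_smul c)]
  exact partialDeriv_smul hf c k p

lemma pderiv_mul {f g : C(Torus d, ℂ)} (hf : IsCn 1 f) (hg : IsCn 1 g) (k : Fin d) :
    pderiv k (f * g) = pderiv k f * g + f * pderiv k g := by
  ext p
  rw [ContinuousMap.add_apply, ContinuousMap.mul_apply, ContinuousMap.mul_apply,
    pderiv_apply hf, pderiv_apply hg, pderiv_apply (f := f * g) (hf.mul hg)]
  have h := deriv_mul (differentiableAt_shift hf k p) (differentiableAt_shift hg k p)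
  simp only [AddCircle.coe_zero, Pi.single_zero, add_zero] at h
  exact h

lemma pderiv_sum {ι : Type*} {s : Finset ι} {f : ι → C(Torus d, ℂ)}
    (hf : ∀ i ∈ s, IsCn 1 (f i)) (k : Fin d) :
    pderiv k (∑ i ∈ s, f i) = ∑ i ∈ s, pderiv k (f i) := by
  classical
  induction s using Finset.induction_on with
  | empty =>
    -- The derivative of the zero function, obtained by writing it as `0 • planeWave 0`.
    have h := pderiv_smul (isCn_planeWave 1 (0 : Lattice d)) 0 k
    simpa using h
  | insert a s ha ih =>
    have h1 : ∀ i ∈ s, IsCn 1 (f i) := fun i hi => hf i (Finset.mem_insert_of_mem hi)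
    have h2 : IsCn 1 (∑ i ∈ s, f i : C(Torus d, ℂ)) := by
      rw [ContinuousMap.coe_sum]; exact IsCn.sum h1
    rw [Finset.sum_insert ha, Finset.sum_insert ha,
      pderiv_add (hf a (Finset.mem_insert_self a s)) h2, ih h1]

lemma pderiv_star {f : C(Torus d, ℂ)} (hf : IsCn 1 f) (k : Fin d) :
    pderiv k (star f) = star (pderiv k f) := by
  ext p
  rw [ContinuousMap.star_apply, pderiv_apply hf, pderiv_apply (f := star f) hf.star]
  have h := (differentiableAt_shift hf k p).hasDerivAt.star
  exact h.deriv

lemma pderiv_comm {f : C(Torus d, ℂ)} (hf : IsCn 2 f) (j k : Fin d) :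
    pderiv j (pderiv k f) = pderiv k (pderiv j f) := by
  have h1 : IsCn 1 f := hf.of_le (by norm_num)
  have key : ∀ (j k : Fin d) (x : Fin d → ℝ), pderiv j (pderiv k f) (proj x) =
      fderiv ℝ (fderiv ℝ fun y : Fin d → ℝ => f (proj y)) x (Pi.single j 1) (Pi.single k 1) := by
    intro j k x
    have h2 : IsCn 1 (pderiv k f) := IsCn.pderiv (n := 1) (hf.of_le (by norm_num)) k
    rw [pderiv_apply h2, partialDeriv_proj h2, coe_pderiv h1]
    simp only [partialDeriv_proj h1]
    have h3 : DifferentiableAt ℝ (fderiv ℝ fun y : Fin d → ℝ => f (proj y)) x :=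
      (ContDiff.differentiable (n := 1) (ContDiff.fderiv_right (n := 2) hf (by norm_num))
        (by simp)) x
    rw [fderiv_clm_apply h3 (by fun_prop)]
    simp
  ext p
  obtain ⟨x, rfl⟩ := isOpenQuotientMap_proj.surjective p
  rw [key, key]
  exact (ContDiffAt.isSymmSndFDerivAt (n := 2) (ContDiff.contDiffAt hf) (by simp)) _ _

lemma pderiv_planeWave (x : Lattice d) (k : Fin d) :
    pderiv k (planeWave x) = (-Complex.I * (x k : ℂ)) • planeWave x := by
  have h1 := isCn_planeWave 1 x
  ext p
  obtain ⟨q, rfl⟩ := isOpenQuotientMap_proj.surjective p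
  rw [pderiv_apply h1, ContinuousMap.smul_apply, smul_eq_mul]
  unfold partialDeriv
  have h2 : (fun t : ℝ => planeWave x (proj q + Pi.single k (t : AddCircle (2 * Real.pi)))) =
      fun t : ℝ => Complex.exp (t * (-Complex.I * (x k : ℂ))) * planeWave x (proj q) := by
    funext t
    have h3 : proj q + Pi.single k (t : AddCircle (2 * Real.pi)) = proj (q + Pi.single k t) := by
      funext i
      by_cases hi : i = k
      · subst hi; simp [proj]
      · simp [proj, hi]
    rw [h3, planeWave_proj, planeWave_proj, ← Complex.exp_add]
    congr 1
    simp only [Pi.add_apply, Complex.ofReal_add, add_mul, Finset.sum_add_distrib, mul_add]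
    rw [Finset.sum_eq_single (f := fun i => ((Pi.single k t : Fin d → ℝ) i : ℂ) * (x i : ℂ)) k
      (fun i _ hi => by simp [hi]) (by simp)]
    simp only [Pi.single_eq_same]
    ring
  rw [h2]
  have h4 : HasDerivAt (fun t : ℝ => Complex.exp (t * (-Complex.I * (x k : ℂ))) *
      planeWave x (proj q)) _ 0 :=
    (((Complex.ofRealCLM.hasDerivAt (x := (0 : ℝ))).mul_const
      (-Complex.I * (x k : ℂ))).cexp).mul_const _
  rw [h4.deriv]
  simp

/-! ### Integration by parts -/

lemma integrable_continuousMap (f : C(Torus d, ℂ)) : Integrable f (haarTorus d) :=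
  f.continuous.integrable_of_hasCompactSupport (HasCompactSupport.of_compactSpace f)

lemma hasDerivAt_integral_shift {f : C(Torus d, ℂ)} (hf : IsCn 1 f) (k : Fin d) (t₀ : ℝ) :
    HasDerivAt
      (fun t : ℝ => ∫ p, f (p + Pi.single k (t : AddCircle (2 * Real.pi))) ∂(haarTorus d))
      (∫ p, pderiv k f (p + Pi.single k (t₀ : AddCircle (2 * Real.pi))) ∂(haarTorus d)) t₀ := by
  have hcont : ∀ (g : C(Torus d, ℂ)) (t : ℝ), Continuous fun p : Torus d =>
      g (p + Pi.single k (t : AddCircle (2 * Real.pi))) := fun g t => by fun_prop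
  have hint : Integrable (fun p : Torus d =>
      f (p + Pi.single k (t₀ : AddCircle (2 * Real.pi)))) (haarTorus d) :=
    integrable_continuousMap (ContinuousMap.mk _ (hcont f t₀))
  have hF : ∀ᶠ t : ℝ in 𝓝 t₀, AEStronglyMeasurable (fun p : Torus d =>
      f (p + Pi.single k (t : AddCircle (2 * Real.pi)))) (haarTorus d) :=
    Eventually.of_forall fun t => (hcont f t).aestronglyMeasurable
  have hF' : AEStronglyMeasurable (fun p : Torus d =>
      pderiv k f (p + Pi.single k (t₀ : AddCircle (2 * Real.pi)))) (haarTorus d) :=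
    (hcont _ t₀).aestronglyMeasurable
  have hb : ∀ᵐ p ∂(haarTorus d), ∀ t ∈ (Set.univ : Set ℝ),
      ‖pderiv k f (p + Pi.single k (t : AddCircle (2 * Real.pi)))‖ ≤ ‖pderiv k f‖ :=
    Eventually.of_forall fun p t _ => ContinuousMap.norm_coe_le_norm _ _
  exact (hasDerivAt_integral_of_dominated_loc_of_deriv_le univ_mem hF hint hF' hb
    (integrable_const _) (Eventually.of_forall fun p t _ => hasDerivAt_shift hf k p t)).2

/-- By invariance of Haar measure the integral of a translate of `f` is constant in `t`, and its
derivative at `0` is the integral of `∂_k f`. This replaces boundary terms in integration by parts.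
-/
lemma integral_pderiv {f : C(Torus d, ℂ)} (hf : IsCn 1 f) (k : Fin d) :
    ∫ p, pderiv k f p ∂(haarTorus d) = 0 := by
  have h := hasDerivAt_integral_shift hf k 0
  simp only [integral_add_right_eq_self (μ := haarTorus d)] at h
  exact h.unique (hasDerivAt_const _ _)

/-- The embedding `C(Γ*) → L²(Γ*)`. -/
abbrev toL2 (d : ℕ) : C(Torus d, ℂ) →L[ℂ] TorusL2 d :=
  ContinuousMap.toLp (E := ℂ) 2 (haarTorus d) ℂ

lemma inner_toL2 (f g : C(Torus d, ℂ)) :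
    inner ℂ (toL2 d f) (toL2 d g) = ∫ p, (star f * g) p ∂(haarTorus d) := by
  rw [ContinuousMap.inner_toLp]
  refine integral_congr_ae (Eventually.of_forall fun p => ?_)
  simp [mul_comm]

lemma inner_pderiv_left {f g : C(Torus d, ℂ)} (hf : IsCn 1 f) (hg : IsCn 1 g) (k : Fin d) :
    inner ℂ (toL2 d (pderiv k f)) (toL2 d g) = -inner ℂ (toL2 d f) (toL2 d (pderiv k g)) := by
  have h := integral_pderiv (f := star f * g) (hf.star.mul hg) k
  rw [pderiv_mul (f := star f) hf.star hg, pderiv_star hf] at h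
  simp only [ContinuousMap.add_apply] at h
  rw [integral_add (integrable_continuousMap _) (integrable_continuousMap _),
    ← inner_toL2, ← inner_toL2] at h
  exact eq_neg_of_add_eq_zero_left h

lemma inner_mul_left_toL2 (m f g : C(Torus d, ℂ)) :
    inner ℂ (toL2 d (m * f)) (toL2 d g) = inner ℂ (toL2 d f) (toL2 d (star m * g)) := by
  rw [inner_toL2, inner_toL2, star_mul, mul_assoc]

lemma mulOp_toL2 (m f : C(Torus d, ℂ)) : mulOp m (toL2 d f) = toL2 d (m * f) := by
  refine Lp.ext ?_
  filter_upwards [mulOp_ae m (toL2 d f), ContinuousMap.coeFn_toLp (p := 2) (𝕜 := ℂ) (haarTorus d) f,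
    ContinuousMap.coeFn_toLp (p := 2) (𝕜 := ℂ) (haarTorus d) (m * f)] with p h1 h2 h3
  rw [h1, h2, h3, ContinuousMap.mul_apply]

lemma norm_mulOp_apply_le (m : C(Torus d, ℂ)) (f : TorusL2 d) : ‖mulOp m f‖ ≤ ‖m‖ * ‖f‖ := by
  refine Lp.norm_le_mul_norm_of_ae_le_mul ?_
  filter_upwards [mulOp_ae m f] with p hp
  rw [hp, norm_mul]
  gcongr
  exact ContinuousMap.norm_coe_le_norm _ _

lemma norm_toL2_mul_le (m f : C(Torus d, ℂ)) : ‖toL2 d (m * f)‖ ≤ ‖m‖ * ‖toL2 d f‖ := by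
  rw [← mulOp_toL2]
  exact norm_mulOp_apply_le _ _

/-! ### The first-order differential expression -/

/-- The expression `i ∑_k { (∂_k E) (∂_k f) + ½ (∂_k² E) f }`. -/
def firstOrder (E f : C(Torus d, ℂ)) : C(Torus d, ℂ) :=
  Complex.I • ∑ k, (pderiv k E * pderiv k f + (1 / 2 : ℂ) • (pderiv k (pderiv k E) * f))

/-- The commutator of `∂_j` with `firstOrder E`. -/
def firstOrderComm (E : C(Torus d, ℂ)) (j : Fin d) (f : C(Torus d, ℂ)) : C(Torus d, ℂ) :=
  Complex.I • ∑ k, (pderiv j (pderiv k E) * pderiv k f +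
    (1 / 2 : ℂ) • (pderiv j (pderiv k (pderiv k E)) * f))

/-- Moving `∂_k` across the inner product produces an extra `∂_k²E`. The two halves of the
zero-order term share it symmetrically, and the `i` in front compensates the sign. -/
lemma inner_firstOrder {E f g : C(Torus d, ℂ)} (hE : IsCn 2 E) (hs : star E = E) (hf : IsCn 1 f)
    (hg : IsCn 1 g) :
    inner ℂ (toL2 d (firstOrder E f)) (toL2 d g) =
      inner ℂ (toL2 d f) (toL2 d (firstOrder E g)) := by
  have hE1 : IsCn 1 E := hE.of_le (by norm_num)
  have hEk : ∀ k, IsCn 1 (pderiv k E) := fun k => IsCn.pderiv (hE.of_le (by norm_num)) k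
  have hsk : ∀ k, star (pderiv k E) = pderiv k E := fun k => by rw [← pderiv_star hE1, hs]
  have hskk : ∀ k, star (pderiv k (pderiv k E)) = pderiv k (pderiv k E) := fun k => by
    rw [← pderiv_star (hEk k), hsk]
  have h1 : ∀ k, inner ℂ (toL2 d (pderiv k E * pderiv k f)) (toL2 d g) =
      -inner ℂ (toL2 d f) (toL2 d (pderiv k (pderiv k E) * g)) -
        inner ℂ (toL2 d f) (toL2 d (pderiv k E * pderiv k g)) := by
    intro k
    rw [inner_mul_left_toL2, hsk, inner_pderiv_left hf (g := pderiv k E * g) ((hEk k).mul hg),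
      pderiv_mul (hEk k) hg, map_add, inner_add_right]
    ring
  simp only [firstOrder, map_smul, map_sum, map_add, inner_smul_left, inner_smul_right, sum_inner,
    inner_sum, inner_add_left, inner_add_right, h1]
  simp only [inner_mul_left_toL2, hskk, Complex.conj_I, Finset.mul_sum]
  refine Finset.sum_congr rfl fun k _ => ?_
  simp only [map_div₀, map_one, map_ofNat]
  ring

/-- The second derivatives of `f` cancel in the commutator because partial derivatives commute. What
remains is of first order, with derivatives of `E` up to the third. -/
lemma pderiv_firstOrder {E f : C(Torus d, ℂ)} (hE : IsCn 3 E) (hf : IsCn 2 f) (j : Fin d) :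
    pderiv j (firstOrder E f) = firstOrder E (pderiv j f) + firstOrderComm E j f := by
  have hf1 : IsCn 1 f := hf.of_le (by norm_num)
  have hfk : ∀ k, IsCn 1 (pderiv k f) := fun k => IsCn.pderiv (hf.of_le (by norm_num)) k
  have hEk : ∀ k, IsCn 2 (pderiv k E) := fun k => IsCn.pderiv (hE.of_le (by norm_num)) k
  have hEk1 : ∀ k, IsCn 1 (pderiv k E) := fun k => (hEk k).of_le (by norm_num)
  have hEkk : ∀ k, IsCn 1 (pderiv k (pderiv k E)) := fun k =>
    IsCn.pderiv ((hEk k).of_le (by norm_num)) k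
  have ha : ∀ k, IsCn 1 (pderiv k E * pderiv k f : C(Torus d, ℂ)) := fun k =>
    (hEk1 k).mul (hfk k)
  have hb : ∀ k, IsCn 1 (pderiv k (pderiv k E) * f : C(Torus d, ℂ)) := fun k =>
    (hEkk k).mul hf1
  have hb' : ∀ k, IsCn 1 ((1 / 2 : ℂ) • (pderiv k (pderiv k E) * f) : C(Torus d, ℂ)) := fun k =>
    IsCn.const_smul (f := ⇑(pderiv k (pderiv k E) * f)) _ (hb k)
  have hab : ∀ k, IsCn 1 (pderiv k E * pderiv k f +
      (1 / 2 : ℂ) • (pderiv k (pderiv k E) * f) : C(Torus d, ℂ)) := fun k => (ha k).add (hb' k)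
  have hsum : IsCn 1 (∑ k, (pderiv k E * pderiv k f +
      (1 / 2 : ℂ) • (pderiv k (pderiv k E) * f)) : C(Torus d, ℂ)) := by
    rw [ContinuousMap.coe_sum]; exact IsCn.sum fun k _ => hab k
  unfold firstOrder firstOrderComm
  rw [pderiv_smul hsum, pderiv_sum fun k _ => hab k, ← smul_add, ← Finset.sum_add_distrib]
  congr 1
  refine Finset.sum_congr rfl fun k _ => ?_
  rw [pderiv_add (ha k) (hb' k), pderiv_smul (hb k), pderiv_mul (hEk1 k) (hfk k),
    pderiv_mul (hEkk k) hf1, pderiv_comm hf j k, smul_add]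
  abel

/-- No smoothness is needed: `pderiv` is `0` on functions that are not `C¹`, and the bound uses only
the triangle inequality and sup norms of the coefficients. -/
lemma norm_toL2_firstOrder_le (E f : C(Torus d, ℂ)) :
    ‖toL2 d (firstOrder E f)‖ ≤
      ∑ k, (‖pderiv k E‖ * ‖toL2 d (pderiv k f)‖ + ‖pderiv k (pderiv k E)‖ * ‖toL2 d f‖) := by
  unfold firstOrder
  rw [map_smul, norm_smul, Complex.norm_I, one_mul, map_sum]
  refine norm_sum_le_of_le _ fun k _ => ?_
  rw [map_add, map_smul]
  refine (norm_add_le _ _).trans (add_le_add (norm_toL2_mul_le _ _) ?_)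
  rw [norm_smul]
  refine (mul_le_of_le_one_left (norm_nonneg _) (by norm_num)).trans (norm_toL2_mul_le _ _)

lemma norm_toL2_firstOrderComm_le (E : C(Torus d, ℂ)) (j : Fin d) (f : C(Torus d, ℂ)) :
    ‖toL2 d (firstOrderComm E j f)‖ ≤
      ∑ k, (‖pderiv j (pderiv k E)‖ * ‖toL2 d (pderiv k f)‖ +
        ‖pderiv j (pderiv k (pderiv k E))‖ * ‖toL2 d f‖) := by
  unfold firstOrderComm
  rw [map_smul, norm_smul, Complex.norm_I, one_mul, map_sum]
  refine norm_sum_le_of_le _ fun k _ => ?_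
  rw [map_add, map_smul]
  refine (norm_add_le _ _).trans (add_le_add (norm_toL2_mul_le _ _) ?_)
  rw [norm_smul]
  refine (mul_le_of_le_one_left (norm_nonneg _) (by norm_num)).trans (norm_toL2_mul_le _ _)

/-- The comparison operator `1 - Δ`. -/
def oneSubLaplacian (f : C(Torus d, ℂ)) : C(Torus d, ℂ) := f - ∑ j, pderiv j (pderiv j f)

/-- The squared `H¹` norm. -/
def sobolevSq (f : C(Torus d, ℂ)) : ℝ := ‖toL2 d f‖ ^ 2 + ∑ j, ‖toL2 d (pderiv j f)‖ ^ 2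

lemma sobolevSq_nonneg (f : C(Torus d, ℂ)) : 0 ≤ sobolevSq f := by
  unfold sobolevSq; positivity

lemma norm_toL2_le_sqrt_sobolevSq (f : C(Torus d, ℂ)) : ‖toL2 d f‖ ≤ √(sobolevSq f) := by
  refine Real.le_sqrt_of_sq_le ?_
  unfold sobolevSq
  exact le_add_of_nonneg_right (Finset.sum_nonneg fun _ _ => sq_nonneg _)

lemma norm_toL2_pderiv_le_sqrt_sobolevSq (f : C(Torus d, ℂ)) (j : Fin d) :
    ‖toL2 d (pderiv j f)‖ ≤ √(sobolevSq f) := by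
  refine Real.le_sqrt_of_sq_le ?_
  unfold sobolevSq
  have h := Finset.single_le_sum (f := fun j => ‖toL2 d (pderiv j f)‖ ^ 2)
    (fun _ _ => sq_nonneg _) (Finset.mem_univ j)
  have h2 := sq_nonneg ‖toL2 d f‖
  linarith

lemma inner_oneSubLaplacian {f g : C(Torus d, ℂ)} (hf : IsCn 2 f) (hg : IsCn 1 g) :
    inner ℂ (toL2 d (oneSubLaplacian f)) (toL2 d g) =
      inner ℂ (toL2 d f) (toL2 d g) +
        ∑ j, inner ℂ (toL2 d (pderiv j f)) (toL2 d (pderiv j g)) := by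
  have hfk : ∀ k, IsCn 1 (pderiv k f) := fun k => IsCn.pderiv (hf.of_le (by norm_num)) k
  simp only [oneSubLaplacian, map_sub, map_sum, inner_sub_left, sum_inner,
    inner_pderiv_left (hfk _) hg, Finset.sum_neg_distrib, sub_neg_eq_add]

lemma inner_oneSubLaplacian_self {f : C(Torus d, ℂ)} (hf : IsCn 2 f) :
    inner ℂ (toL2 d (oneSubLaplacian f)) (toL2 d f) = (sobolevSq f : ℂ) := by
  rw [inner_oneSubLaplacian hf (hf.of_le (by norm_num))]
  simp only [inner_self_eq_norm_sq_to_K, sobolevSq]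
  push_cast
  rfl

/-- With `N = 1 - Δ`, the squared Sobolev norm is `⟨Nf, f⟩ ≤ ‖Nf‖ ‖f‖`, and `‖f‖` is at most the
Sobolev norm; one factor is divided out. -/
lemma sqrt_sobolevSq_le {f : C(Torus d, ℂ)} (hf : IsCn 2 f) :
    √(sobolevSq f) ≤ ‖toL2 d (oneSubLaplacian f)‖ := by
  have h1 : sobolevSq f ≤ ‖toL2 d (oneSubLaplacian f)‖ * ‖toL2 d f‖ := by
    have h := norm_inner_le_norm (𝕜 := ℂ) (toL2 d (oneSubLaplacian f)) (toL2 d f)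
    rw [inner_oneSubLaplacian_self hf, Complex.norm_real, Real.norm_eq_abs,
      abs_of_nonneg (sobolevSq_nonneg f)] at h
    exact h
  have h2 := norm_toL2_le_sqrt_sobolevSq f
  have h3 := Real.mul_self_sqrt (sobolevSq_nonneg f)
  rcases (Real.sqrt_nonneg (sobolevSq f)).eq_or_lt with h0 | h0
  · rw [← h0]; exact norm_nonneg _
  · refine le_of_mul_le_mul_right ?_ h0
    rw [h3]
    exact h1.trans (mul_le_mul_of_nonneg_left h2 (norm_nonneg _))

/-- `firstOrder E` is relatively bounded with respect to `(1 - Δ)^{1/2}`. -/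
lemma exists_norm_firstOrder_le (E : C(Torus d, ℂ)) :
    ∃ C : ℝ, 0 ≤ C ∧ ∀ f : C(Torus d, ℂ), ‖toL2 d (firstOrder E f)‖ ≤ C * √(sobolevSq f) := by
  refine ⟨∑ k, (‖pderiv k E‖ + ‖pderiv k (pderiv k E)‖), by positivity, fun f => ?_⟩
  refine (norm_toL2_firstOrder_le E f).trans ?_
  rw [Finset.sum_mul]
  refine Finset.sum_le_sum fun k _ => ?_
  rw [add_mul]
  gcongr
  · exact norm_toL2_pderiv_le_sqrt_sobolevSq f k
  · exact norm_toL2_le_sqrt_sobolevSq f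

/-- The form bound on the commutator of `firstOrder E` with `1 - Δ`. -/
lemma exists_abs_im_inner_firstOrder_le {E : C(Torus d, ℂ)} (hE : IsCn 3 E) (hs : star E = E) :
    ∃ c : ℝ, 0 ≤ c ∧ ∀ f : C(Torus d, ℂ), IsCn 2 f →
      |(inner ℂ (toL2 d (oneSubLaplacian f)) (toL2 d (firstOrder E f))).im| ≤
        c * sobolevSq f := by
  refine ⟨∑ j, ∑ k, (‖pderiv j (pderiv k E)‖ + ‖pderiv j (pderiv k (pderiv k E))‖),
    by positivity, fun f hf => ?_⟩
  have hE2 : IsCn 2 E := hE.of_le (by norm_num)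
  have hreal : ∀ g : C(Torus d, ℂ), IsCn 1 g →
      (inner ℂ (toL2 d g) (toL2 d (firstOrder E g))).im = 0 := by
    intro g hg
    refine Complex.conj_eq_iff_im.mp ?_
    rw [inner_conj_symm]
    exact inner_firstOrder hE2 hs hg hg
  have hf1 : IsCn 1 f := hf.of_le (by norm_num)
  have hfk : ∀ k, IsCn 1 (pderiv k f) := fun k => IsCn.pderiv (hf.of_le (by norm_num)) k
  have hD : IsCn 1 (firstOrder E f) := by
    have hEk : ∀ k, IsCn 2 (pderiv k E) := fun k => IsCn.pderiv (hE.of_le (by norm_num)) k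
    have hEkk : ∀ k, IsCn 1 (pderiv k (pderiv k E)) := fun k =>
      IsCn.pderiv ((hEk k).of_le (by norm_num)) k
    unfold firstOrder
    refine IsCn.const_smul (f := ⇑(∑ k, (pderiv k E * pderiv k f +
      (1 / 2 : ℂ) • (pderiv k (pderiv k E) * f)) : C(Torus d, ℂ))) _ ?_
    rw [ContinuousMap.coe_sum]
    refine IsCn.sum fun k _ => IsCn.add (f := ⇑(pderiv k E * pderiv k f))
      (((hEk k).of_le (by norm_num)).mul (hfk k)) ?_
    exact IsCn.const_smul (f := ⇑(pderiv k (pderiv k E) * f)) _ ((hEkk k).mul hf1)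
  -- The form of `1 - Δ` splits into `⟨f, Df⟩` and the `⟨∂_j f, ∂_j Df⟩`, where `D` is `firstOrder
  -- E`. Symmetry of `D` makes all contributions real except those of the commutators `[∂_j, D]`.
  rw [inner_oneSubLaplacian hf hD, Complex.add_im, hreal f hf1, zero_add, Complex.im_sum,
    Finset.sum_mul]
  refine (Finset.abs_sum_le_sum_abs _ _).trans (Finset.sum_le_sum fun j _ => ?_)
  rw [pderiv_firstOrder hE hf, map_add, inner_add_right, Complex.add_im, hreal _ (hfk j), zero_add]
  refine (Complex.abs_im_le_norm _).trans ((norm_inner_le_norm _ _).trans ?_)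
  rw [← Real.mul_self_sqrt (sobolevSq_nonneg f), ← mul_assoc, mul_comm]
  refine mul_le_mul ?_ (norm_toL2_pderiv_le_sqrt_sobolevSq f j) (norm_nonneg _) (by positivity)
  refine (norm_toL2_firstOrderComm_le E j f).trans ?_
  rw [Finset.sum_mul]
  refine Finset.sum_le_sum fun k _ => ?_
  rw [add_mul]
  gcongr
  · exact norm_toL2_pderiv_le_sqrt_sobolevSq f k
  · exact norm_toL2_le_sqrt_sobolevSq f

/-! ### Trigonometric polynomials -/

/-- The trigonometric polynomial with frequencies in `S` and coefficients `a`. -/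
def trigPoly (S : Finset (Lattice d)) (a : Lattice d → ℂ) : C(Torus d, ℂ) :=
  ∑ x ∈ S, a x • planeWave x

lemma isCn_trigPoly (n : WithTop ℕ∞) (S : Finset (Lattice d)) (a : Lattice d → ℂ) :
    IsCn n (trigPoly S a) := by
  unfold trigPoly
  rw [ContinuousMap.coe_sum]
  exact IsCn.sum fun x _ => (isCn_planeWave n x).const_smul _

lemma pderiv_trigPoly (S : Finset (Lattice d)) (a : Lattice d → ℂ) (k : Fin d) :
    pderiv k (trigPoly S a) = trigPoly S fun x => -Complex.I * (x k : ℂ) * a x := by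
  unfold trigPoly
  rw [pderiv_sum fun x _ => (isCn_planeWave 1 x).const_smul _]
  refine Finset.sum_congr rfl fun x _ => ?_
  rw [pderiv_smul (isCn_planeWave 1 x), pderiv_planeWave, smul_smul, mul_comm (a x)]

/-- On plane waves `1 - Δ` is diagonal with eigenvalues `1 + |x|²`, all nonzero, so it can be
inverted explicitly on trigonometric polynomials. -/
lemma oneSubLaplacian_trigPoly (S : Finset (Lattice d)) (a : Lattice d → ℂ) :
    oneSubLaplacian (trigPoly S a) =
      trigPoly S fun x => ((1 + ∑ j, (x j : ℝ) ^ 2 : ℝ) : ℂ) * a x := by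
  unfold oneSubLaplacian
  simp only [pderiv_trigPoly]
  unfold trigPoly
  rw [Finset.sum_comm, ← Finset.sum_sub_distrib]
  refine Finset.sum_congr rfl fun x _ => ?_
  rw [← Finset.sum_smul, ← sub_smul]
  congr 1
  push_cast
  rw [add_mul, one_mul, sub_eq_add_neg, ← Finset.sum_neg_distrib, Finset.sum_mul]
  congr 1
  refine Finset.sum_congr rfl fun j _ => ?_
  linear_combination (-(x j : ℂ) ^ 2 * a x) * Complex.I_sq

lemma toL2_trigPoly (S : Finset (Lattice d)) (a : Lattice d → ℂ) :
    toL2 d (trigPoly S a) = ∑ x ∈ S, a x • toL2 d (planeWave x) := by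
  simp [trigPoly, map_sum]

/-- Fourier series converge in `L²(Γ*)`. -/
lemma tendsto_trigPoly (ψ : TorusL2 d) :
    Tendsto (fun S => toL2 d (trigPoly S fun x => inner ℂ (toL2 d (planeWave x)) ψ)) atTop
      (𝓝 ψ) := by
  have h := (planeWaveBasis d).hasSum_repr ψ
  have hb : ⇑(planeWaveBasis d) = fun x : Lattice d => toL2 d (planeWave x) := HilbertBasis.coe_mk _ _
  simp only [HilbertBasis.repr_apply_apply, hb] at h
  simp only [toL2_trigPoly]
  exact h

lemma eq_zero_of_inner_planeWave {ψ : TorusL2 d}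
    (h : ∀ x, inner ℂ (toL2 d (planeWave x)) ψ = 0) : ψ = 0 := by
  refine tendsto_nhds_unique (tendsto_trigPoly ψ) ?_
  simp [h, toL2_trigPoly]

lemma inner_planeWave_pderiv {f : C(Torus d, ℂ)} (hf : IsCn 1 f) (k : Fin d) (x : Lattice d) :
    inner ℂ (toL2 d (planeWave x)) (toL2 d (pderiv k f)) =
      -Complex.I * (x k : ℂ) * inner ℂ (toL2 d (planeWave x)) (toL2 d f) := by
  have h := inner_pderiv_left (isCn_planeWave 1 x) hf k
  rw [pderiv_planeWave, map_smul, inner_smul_left] at h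
  rw [eq_comm, neg_eq_iff_eq_neg] at h
  rw [h]
  simp

/-! ### Vanishing of the deficiency spaces -/

/-- Nelson's commutator argument: the ranges of `firstOrder E - iκ` on smooth functions are total
for `|κ|` large. -/
lemma exists_deficiency_bound {E : C(Torus d, ℂ)} (hE : IsCn 3 E) (hs : star E = E) :
    ∃ c : ℝ, 0 ≤ c ∧ ∀ κ : ℝ, c < |κ| → ∀ ψ : TorusL2 d,
      (∀ f : C(Torus d, ℂ), IsCn ∞ f →
        inner ℂ ψ (toL2 d (firstOrder E f) - ((κ : ℂ) * Complex.I) • toL2 d f) = 0) → ψ = 0 := by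
  obtain ⟨c, hc0, hc⟩ := exists_abs_im_inner_firstOrder_le hE hs
  obtain ⟨C, hC0, hC⟩ := exists_norm_firstOrder_le E
  refine ⟨c, hc0, fun κ hκ ψ hψ => eq_zero_of_inner_planeWave fun x => ?_⟩
  set a : Lattice d → ℂ := fun x => inner ℂ (toL2 d (planeWave x)) ψ with ha
  set w : Lattice d → ℝ := fun x => 1 + ∑ j, (x j : ℝ) ^ 2 with hw
  have hwpos : ∀ x, 0 < w x := fun x => by simp only [hw]; positivity
  -- Nelson's test function would be `N⁻¹ψ`, with `N = 1 - Δ`, which need not be smooth. Truncating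
  -- its Fourier series gives smooth `f S` with `N (f S) = g S`, the partial Fourier sum of `ψ`.
  let f : Finset (Lattice d) → C(Torus d, ℂ) := fun S => trigPoly S fun x => (w x : ℂ)⁻¹ * a x
  let g : Finset (Lattice d) → C(Torus d, ℂ) := fun S => trigPoly S a
  have hfC : ∀ n S, IsCn n (f S) := fun n S => isCn_trigPoly n S _
  have hNf : ∀ S, oneSubLaplacian (f S) = g S := by
    intro S
    rw [oneSubLaplacian_trigPoly]
    refine Finset.sum_congr rfl fun x _ => ?_
    have : (w x : ℂ) ≠ 0 := by exact_mod_cast (hwpos x).ne'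
    change ((w x : ℂ) * ((w x : ℂ)⁻¹ * a x)) • _ = _
    rw [mul_inv_cancel_left₀ this]
  -- The tail `ψ - g S` has no frequencies in `S` and is orthogonal to `f S`, so `ψ` may be replaced
  -- by `g S = N (f S)`.
  have hψf : ∀ S, inner ℂ ψ (toL2 d (f S)) = (sobolevSq (f S) : ℂ) := by
    intro S
    rw [← inner_oneSubLaplacian_self (hfC 2 S), hNf]
    simp only [f, g]
    rw [toL2_trigPoly S fun x => (w x : ℂ)⁻¹ * a x, inner_sum, inner_sum]
    refine Finset.sum_congr rfl fun x hx => ?_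
    rw [inner_smul_right, inner_smul_right, toL2_trigPoly,
      (orthonormal_planeWave d).inner_left_sum a hx, ha, inner_conj_symm]
  -- Orthogonality gives `⟨ψ, D f⟩ = iκ⟨ψ, f⟩`, with `D = firstOrder E`. Take imaginary parts and
  -- split `ψ` into `g S` and the tail: the commutator bound handles `g S` at cost `c`, relative
  -- boundedness of `D` handles the tail.
  have hbound : ∀ S, (|κ| - c) * sobolevSq (f S) ≤
      ‖ψ - toL2 d (g S)‖ * (C * ‖toL2 d (g S)‖) := by
    intro S
    have h1 := hψ (f S) (hfC ∞ S)
    rw [inner_sub_right, inner_smul_right, hψf, sub_eq_zero] at h1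
    have h2 : κ * sobolevSq (f S) = (inner ℂ (toL2 d (g S)) (toL2 d (firstOrder E (f S)))).im +
        (inner ℂ (ψ - toL2 d (g S)) (toL2 d (firstOrder E (f S)))).im := by
      rw [← Complex.add_im, ← inner_add_left, add_sub_cancel, h1]
      simp
    have h3 := hc (f S) (hfC 2 S)
    rw [hNf] at h3
    have h4 : |(inner ℂ (ψ - toL2 d (g S)) (toL2 d (firstOrder E (f S)))).im| ≤
        ‖ψ - toL2 d (g S)‖ * (C * ‖toL2 d (g S)‖) := by
      refine (Complex.abs_im_le_norm _).trans ((norm_inner_le_norm _ _).trans ?_)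
      gcongr
      refine (hC _).trans ?_
      gcongr
      rw [← hNf]
      exact sqrt_sobolevSq_le (hfC 2 S)
    have h5 : |κ| * sobolevSq (f S) = |κ * sobolevSq (f S)| := by
      rw [abs_mul, abs_of_nonneg (sobolevSq_nonneg _)]
    have h6 := abs_add_le (inner ℂ (toL2 d (g S)) (toL2 d (firstOrder E (f S)))).im
      (inner ℂ (ψ - toL2 d (g S)) (toL2 d (firstOrder E (f S)))).im
    rw [← h2, ← h5] at h6
    linarith
  have hlower : ∀ S, x ∈ S → ‖(w x : ℂ)⁻¹ * a x‖ ^ 2 ≤ sobolevSq (f S) := by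
    intro S hx
    have h1 : inner ℂ (toL2 d (planeWave x)) (toL2 d (f S)) = (w x : ℂ)⁻¹ * a x := by
      simp only [f]
      rw [toL2_trigPoly]
      exact (orthonormal_planeWave d).inner_right_sum _ hx
    have h2 := norm_inner_le_norm (𝕜 := ℂ) (toL2 d (planeWave x)) (toL2 d (f S))
    rw [h1, (orthonormal_planeWave d).1 x, one_mul] at h2
    have h3 : ‖toL2 d (f S)‖ ^ 2 ≤ sobolevSq (f S) := by
      unfold sobolevSq
      exact le_add_of_nonneg_right (Finset.sum_nonneg fun _ _ => sq_nonneg _)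
    exact (pow_le_pow_left₀ (norm_nonneg _) h2 2).trans h3
  have hlim : Tendsto (fun S => ‖ψ - toL2 d (g S)‖ * (C * ‖toL2 d (g S)‖)) atTop (𝓝 0) := by
    have h1 : Tendsto (fun S => toL2 d (g S)) atTop (𝓝 ψ) := tendsto_trigPoly ψ
    have h2 := (tendsto_const_nhds (x := ψ).sub h1).norm.mul (h1.norm.const_mul C)
    simpa using h2
  -- The tail error tends to zero, while the left side is a fixed coefficient once `x ∈ S`; since
  -- `|κ| > c`, that coefficient vanishes.
  have hle : (|κ| - c) * ‖(w x : ℂ)⁻¹ * a x‖ ^ 2 ≤ 0 := by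
    refine ge_of_tendsto hlim ?_
    filter_upwards [eventually_ge_atTop {x}] with S hS
    have hx : x ∈ S := hS (Finset.mem_singleton_self x)
    exact (mul_le_mul_of_nonneg_left (hlower S hx) (by linarith)).trans (hbound S)
  have hzero : ‖(w x : ℂ)⁻¹ * a x‖ ^ 2 = 0 :=
    le_antisymm (nonpos_of_mul_nonpos_right hle (by linarith)) (sq_nonneg _)
  have hwx : (w x : ℂ)⁻¹ ≠ 0 := inv_ne_zero (by exact_mod_cast (hwpos x).ne')
  exact (mul_eq_zero.mp (norm_eq_zero.mp (sq_eq_zero_iff.mp hzero))).resolve_left hwx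

/-! ### The conjugate operator and its closure -/

lemma partialDeriv_ofReal {g : Torus d → ℝ} (hg : IsCn 1 g) (k : Fin d) (p : Torus d) :
    partialDeriv k (fun q => (g q : ℂ)) p = ((partialDeriv k g p : ℝ) : ℂ) :=
  ((differentiableAt_shift hg k p).hasDerivAt.ofReal_comp).deriv

lemma Dispersion.isC1_toC (e : Dispersion d) : IsCn 1 e.toC :=
  IsCn.ofReal (ContDiff.of_le (n := 2) e.isC2 (by norm_num))

lemma Dispersion.isC2_toC (e : Dispersion d) : IsCn 2 e.toC := IsCn.ofReal e.isC2

lemma Dispersion.star_toC (e : Dispersion d) : star e.toC = e.toC := by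
  ext p
  simp [Dispersion.toC]

lemma Dispersion.coe_pderiv_toC (e : Dispersion d) (k : Fin d) :
    ⇑(pderiv k e.toC) = fun p => ((partialDeriv k e.toFun p : ℝ) : ℂ) := by
  rw [coe_pderiv e.isC1_toC]
  funext p
  exact partialDeriv_ofReal (ContDiff.of_le (n := 2) e.isC2 (by norm_num)) k p

lemma diffExpr_eq_firstOrder (e : Dispersion d) (f : smoothFunctions d) :
    diffExpr e f = firstOrder e.toC f := by
  have h1 : ∀ k, IsCn 1 (partialDeriv k e.toFun) := fun k => IsCn.partialDeriv (n := 1) e.isC2 k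
  have h2 : ∀ k, IsCn 1 (pderiv k e.toC) := fun k => IsCn.pderiv (n := 1) e.isC2_toC k
  ext p
  simp only [diffExpr, firstOrder, LinearMap.coe_mk, AddHom.coe_mk, ContinuousMap.coe_mk,
    ContinuousMap.smul_apply, ContinuousMap.coe_sum, Finset.sum_apply, ContinuousMap.add_apply,
    ContinuousMap.mul_apply, smul_eq_mul, pderiv_apply (smoothFunctions.isC1 f),
    pderiv_apply (h2 _), Dispersion.coe_pderiv_toC, partialDeriv_ofReal (h1 _)]
  congr 1
  refine Finset.sum_congr rfl fun k _ => ?_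
  ring

/-- Removes the subtype and inverse-embedding bookkeeping of `conjugateOp`, so that later arguments
work with functions on the torus. -/
lemma mem_graph_conjugateOp_iff (e : Dispersion d) (φ η : SeqL2 d) :
    (φ, η) ∈ (conjugateOp e).graph ↔ ∃ f : C(Torus d, ℂ), IsCn ∞ f ∧
      fourierF d (toL2 d f) = φ ∧ fourierF d (toL2 d (firstOrder e.toC f)) = η := by
  have hval : ∀ (f : smoothFunctions d) (h : smoothToL2 d f ∈ (conjugateHat e).domain),
      conjugateHat e ⟨smoothToL2 d f, h⟩ = toL2 d (firstOrder e.toC f) := by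
    intro f h
    rw [← diffExpr_eq_firstOrder]
    change toL2 d (diffExpr e ((LinearEquiv.ofInjective (smoothToL2 d)
      (smoothToL2_injective d)).symm ⟨smoothToL2 d f, h⟩)) = _
    congr 2
    rw [LinearEquiv.symm_apply_eq]
    rfl
  rw [LinearPMap.mem_graph_iff]
  constructor
  · rintro ⟨⟨y, hy⟩, rfl, rfl⟩
    obtain ⟨f, hf⟩ := id hy
    refine ⟨f, f.2, ?_, ?_⟩
    · change smoothToL2 d f = (fourierF d).symm y at hf
      change fourierF d (smoothToL2 d f) = y
      rw [hf, LinearIsometryEquiv.apply_symm_apply]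
    · rw [← hval f ⟨f, rfl⟩]
      change _ = fourierF d (conjugateHat e ⟨(fourierF d).symm y, hy⟩)
      congr 2
      exact Subtype.ext hf
  · rintro ⟨f, hf, rfl, rfl⟩
    let f' : smoothFunctions d := ⟨f, hf⟩
    have hy : fourierF d (toL2 d f) ∈ (conjugateOp e).domain := by
      change (fourierF d).symm (fourierF d (toL2 d f)) ∈ (conjugateHat e).domain
      rw [LinearIsometryEquiv.symm_apply_apply]
      exact ⟨f', rfl⟩
    refine ⟨⟨_, hy⟩, rfl, ?_⟩
    rw [← hval f' ⟨f', rfl⟩]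
    change fourierF d (conjugateHat e ⟨(fourierF d).symm (fourierF d (toL2 d f)), hy⟩) = _
    congr 2
    exact Subtype.ext (LinearIsometryEquiv.symm_apply_apply _ _)

lemma dense_domain_conjugateOp (e : Dispersion d) :
    Dense ((conjugateOp e).domain : Set (SeqL2 d)) := by
  have h1 : Dense ((conjugateHat e).domain : Set (TorusL2 d)) := by
    have h2 := (Submodule.dense_iff_topologicalClosure_eq_top).mpr (span_planeWaveLp_dense d)
    refine h2.mono ?_
    refine Submodule.span_le.mpr ?_
    rintro _ ⟨x, rfl⟩
    exact ⟨⟨planeWave x, isCn_planeWave ∞ x⟩, rfl⟩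
  exact h1.preimage (fourierF d).symm.toHomeomorph.isOpenMap

lemma conjugateOp_isFormalAdjoint (e : Dispersion d) :
    (conjugateOp e).IsFormalAdjoint (conjugateOp e) := by
  intro x y
  obtain ⟨f, hf, hfx, hfx'⟩ := (mem_graph_conjugateOp_iff e _ _).mp ((conjugateOp e).mem_graph x)
  obtain ⟨g, hg, hgy, hgy'⟩ := (mem_graph_conjugateOp_iff e _ _).mp ((conjugateOp e).mem_graph y)
  rw [← hfx, ← hfx', ← hgy, ← hgy', LinearIsometryEquiv.inner_map_map,
    LinearIsometryEquiv.inner_map_map]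
  exact inner_firstOrder e.isC2_toC e.star_toC (hf.of_le (by simp)) (hg.of_le (by simp))

/-- `A(e)` is essentially self-adjoint. -/
lemma isSelfAdjoint_closure_conjugateOp (e : Dispersion d) (he : IsCn 3 e.toFun) :
    IsSelfAdjoint (conjugateOp e).closure := by
  obtain ⟨c, hc0, hc⟩ := exists_deficiency_bound (E := e.toC) he.ofReal e.star_toC
  have key : ∀ κ : ℝ, c < |κ| → ∀ ψ : SeqL2 d, (∀ f : (conjugateOp e).domain,
      inner ℂ ψ (conjugateOp e f - ((κ : ℂ) * Complex.I) • (f : SeqL2 d)) = 0) → ψ = 0 := by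
    intro κ hκ ψ hψ
    have h := hc κ hκ ((fourierF d).symm ψ) fun f hf => by
      obtain ⟨y, hy, hy'⟩ := (LinearPMap.mem_graph_iff _).mp
        ((mem_graph_conjugateOp_iff e _ _).mpr ⟨f, hf, rfl, rfl⟩)
      have h1 := hψ y
      rw [hy, hy', ← map_smul, ← map_sub] at h1
      rw [← LinearIsometryEquiv.inner_map_map (fourierF d), LinearIsometryEquiv.apply_symm_apply]
      exact h1
    simpa using h
  refine (conjugateOp_isFormalAdjoint e).isSelfAdjoint_closure (dense_domain_conjugateOp e)
    -- Both `κ` and `-κ` then exceed the Nelson constant `c` in absolute value.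
    (κ := c + 1) (by positivity) (key _ ?_) (key _ ?_)
  · rw [abs_of_nonneg (by positivity)]; linarith
  · rw [abs_neg, abs_of_nonneg (by positivity)]; linarith

lemma isClosable_conjugateOp (e : Dispersion d) : (conjugateOp e).IsClosable :=
  ((conjugateOp_isFormalAdjoint e).closable_and_closure_le (dense_domain_conjugateOp e)).1

lemma toL2_firstOrder (E f : C(Torus d, ℂ)) :
    toL2 d (firstOrder E f) = Complex.I • ∑ k, (mulOp (pderiv k E) (toL2 d (pderiv k f)) +
      (1 / 2 : ℂ) • mulOp (pderiv k (pderiv k E)) (toL2 d f)) := by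
  simp only [firstOrder, map_smul, map_sum, map_add, mulOp_toL2]

/-- `C¹` functions belong to the domain of the closure of `A(e)`. -/
lemma mem_graph_closure_conjugateOp (e : Dispersion d) {f : C(Torus d, ℂ)} (hf : IsCn 1 f) :
    (fourierF d (toL2 d f), fourierF d (toL2 d (firstOrder e.toC f))) ∈
      (conjugateOp e).closure.graph := by
  rw [← (isClosable_conjugateOp e).graph_closure_eq_closure_graph]
  let g : Finset (Lattice d) → C(Torus d, ℂ) := fun S =>
    trigPoly S fun x => inner ℂ (toL2 d (planeWave x)) (toL2 d f)
  have h0 : Tendsto (fun S => toL2 d (g S)) atTop (𝓝 (toL2 d f)) := tendsto_trigPoly _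
  have h1 : ∀ k, Tendsto (fun S => toL2 d (pderiv k (g S))) atTop (𝓝 (toL2 d (pderiv k f))) := by
    intro k
    have h := tendsto_trigPoly (toL2 d (pderiv k f))
    -- Differentiation commutes with Fourier truncation, so the derivatives of the partial sums are
    -- the partial sums of `∂_k f` and converge in `L²` too.
    simp only [inner_planeWave_pderiv hf] at h
    simp only [g, pderiv_trigPoly]
    exact h
  have h2 : Tendsto (fun S => toL2 d (firstOrder e.toC (g S))) atTop
      (𝓝 (toL2 d (firstOrder e.toC f))) := by
    simp only [toL2_firstOrder]
    refine (tendsto_finsetSum _ fun k _ => ?_).const_smul _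
    exact (((mulOp _).continuous.tendsto _).comp (h1 k)).add
      ((((mulOp _).continuous.tendsto _).comp h0).const_smul _)
  refine mem_closure_of_tendsto (f := fun S => (fourierF d (toL2 d (g S)),
    fourierF d (toL2 d (firstOrder e.toC (g S)))))
    ((((fourierF d).continuous.tendsto _).comp h0).prodMk_nhds
      (((fourierF d).continuous.tendsto _).comp h2)) (b := atTop) ?_
  exact Eventually.of_forall fun S =>
    (mem_graph_conjugateOp_iff e _ _).mpr ⟨g S, isCn_trigPoly ∞ S _, rfl, rfl⟩

/-! ### Fourier multipliers -/

lemma mulOp_mul (m n : C(Torus d, ℂ)) : mulOp (m * n) = mulOp m * mulOp n := by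
  ext1 f
  refine Lp.ext ?_
  filter_upwards [mulOp_ae (m * n) f, mulOp_ae m (mulOp n f), mulOp_ae n f] with p h1 h2 h3
  rw [h1, mul_apply_eq_comp, h2, h3, ContinuousMap.mul_apply, mul_assoc]

lemma mulOp_one : mulOp (1 : C(Torus d, ℂ)) = 1 := by
  ext1 f
  refine Lp.ext ?_
  filter_upwards [mulOp_ae 1 f] with p h1
  rw [h1, ContinuousMap.one_apply, one_mul, one_apply_eq_self]

/-- The Fourier multiplier `F m F*`, as a homomorphism of algebras in `m`. -/
def fourierMul (d : ℕ) : C(Torus d, ℂ) →ₐ[ℂ] (SeqL2 d →L[ℂ] SeqL2 d) :=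
  AlgHom.ofLinearMap
    { toFun := fun m => ((fourierF d).toContinuousLinearEquiv : TorusL2 d →L[ℂ] SeqL2 d) ∘L
        mulOp m ∘L ((fourierF d).symm.toContinuousLinearEquiv : SeqL2 d →L[ℂ] TorusL2 d)
      map_add' := fun m n => by
        ext1 ψ
        change fourierF d (mulOp (m + n) _) = fourierF d (mulOp m _) + fourierF d (mulOp n _)
        rw [← map_add]
        congr 1
        unfold mulOp
        rw [map_add, map_add]
        rfl
      map_smul' := fun c m => by
        ext1 ψ
        change fourierF d (mulOp (c • m) _) = c • fourierF d (mulOp m _)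
        rw [← map_smul]
        congr 1
        unfold mulOp
        rw [map_smul, map_smul]
        rfl }
    (by
      ext1 ψ
      change fourierF d (mulOp 1 ((fourierF d).symm ψ)) = ψ
      rw [mulOp_one]
      exact (fourierF d).apply_symm_apply ψ)
    (fun m n => by
      ext1 ψ
      change fourierF d (mulOp (m * n) ((fourierF d).symm ψ)) =
        fourierF d (mulOp m ((fourierF d).symm (fourierF d (mulOp n ((fourierF d).symm ψ)))))
      rw [LinearIsometryEquiv.symm_apply_apply, mulOp_mul]
      rfl)

lemma fourierMul_apply (m : C(Torus d, ℂ)) (ψ : SeqL2 d) :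
    fourierMul d m ψ = fourierF d (mulOp m ((fourierF d).symm ψ)) := rfl

lemma fourierMul_toC (e : Dispersion d) : fourierMul d e.toC = hopping e := rfl

lemma fourierMul_fourierF (m f : C(Torus d, ℂ)) :
    fourierMul d m (fourierF d (toL2 d f)) = fourierF d (toL2 d (m * f)) := by
  rw [fourierMul_apply, LinearIsometryEquiv.symm_apply_apply, mulOp_toL2]

lemma norm_fourierMul_le (m : C(Torus d, ℂ)) : ‖fourierMul d m‖ ≤ ‖m‖ := by
  refine ContinuousLinearMap.opNorm_le_bound _ (norm_nonneg _) fun ψ => ?_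
  rw [fourierMul_apply, LinearIsometryEquiv.norm_map]
  refine (norm_mulOp_apply_le _ _).trans ?_
  rw [LinearIsometryEquiv.norm_map]

lemma isSelfAdjoint_fourierMul {m : C(Torus d, ℂ)} (hm : star m = m) :
    IsSelfAdjoint (fourierMul d m) := by
  rw [ContinuousLinearMap.isSelfAdjoint_iff_isSymmetric]
  intro φ ψ
  change inner ℂ (fourierF d (mulOp m ((fourierF d).symm φ))) ψ =
    inner ℂ φ (fourierF d (mulOp m ((fourierF d).symm ψ)))
  rw [LinearIsometryEquiv.inner_map_eq_flip]
  conv_rhs => rw [← (fourierF d).apply_symm_apply φ]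
  rw [LinearIsometryEquiv.inner_map_map, L2.inner_def, L2.inner_def]
  refine integral_congr_ae ?_
  filter_upwards [mulOp_ae m ((fourierF d).symm φ), mulOp_ae m ((fourierF d).symm ψ)] with p h1 h2
  have hp : (starRingEnd ℂ) (m p) = m p := DFunLike.congr_fun hm p
  rw [h1, h2]
  simp only [RCLike.inner_apply, map_mul, hp]
  ring

lemma fourierMul_nonneg {m : C(Torus d, ℂ)} (g : Torus d → ℝ) (hg : Continuous g)
    (hg0 : ∀ p, 0 ≤ g p) (hm : ∀ p, m p = g p) : 0 ≤ fourierMul d m := by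
  -- The real square root of the symbol exhibits the multiplier as the square of a self-adjoint one.
  let s : C(Torus d, ℂ) := ⟨fun p => (√(g p) : ℂ), by fun_prop⟩
  have hs : star s = s := by ext p; simp [s]
  have hms : m = s * s := by
    ext p
    rw [hm, ContinuousMap.mul_apply]
    change _ = (√(g p) : ℂ) * (√(g p) : ℂ)
    rw [← Complex.ofReal_mul, Real.mul_self_sqrt (hg0 p)]
  rw [hms, map_mul]
  exact (isSelfAdjoint_fourierMul hs).mul_self_nonneg

/-! ### The commutator -/

/-- The function `∑_k (∂_k E)²`. -/
def gradSq (E : C(Torus d, ℂ)) : C(Torus d, ℂ) := ∑ k, pderiv k E * pderiv k E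

/-- Only the derivative term sees the factor `E`, and the commutator contains no derivative of `f`.
The factor `i` here becomes the sign `+` in `i[E, D] = |∇E|²`, with `D = firstOrder E`. -/
lemma firstOrder_mul {E f : C(Torus d, ℂ)} (hE : IsCn 1 E) (hf : IsCn 1 f) :
    firstOrder E (E * f) = E * firstOrder E f + Complex.I • (gradSq E * f) := by
  unfold firstOrder gradSq
  rw [mul_smul_comm, ← smul_add, Finset.mul_sum, Finset.sum_mul, ← Finset.sum_add_distrib]
  congr 1
  refine Finset.sum_congr rfl fun k _ => ?_
  rw [pderiv_mul hE hf]
  ext p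
  simp only [ContinuousMap.add_apply, ContinuousMap.mul_apply, ContinuousMap.smul_apply,
    smul_eq_mul]
  ring

/-- The hopping matrix preserves the domain of the closure of `A(e)`. -/
lemma hopping_mem_graph (e : Dispersion d) {φ η : SeqL2 d}
    (h : (φ, η) ∈ (conjugateOp e).closure.graph) :
    (hopping e φ, hopping e η + Complex.I • fourierMul d (gradSq e.toC) φ) ∈
      (conjugateOp e).closure.graph := by
  refine (isClosable_conjugateOp e).mem_graph_closure_of_forall (hopping e)
    (Complex.I • fourierMul d (gradSq e.toC)) (fun a b hab => ?_) h
  obtain ⟨f, hf, rfl, rfl⟩ := (mem_graph_conjugateOp_iff e _ _).mp hab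
  have hf1 : IsCn 1 f := hf.of_le (by simp)
  -- The product `e·f` need not be smooth, so it is placed in the domain of the closure rather than
  -- in that of `A(e)`.
  have h1 := mem_graph_closure_conjugateOp e (f := e.toC * f) (e.isC1_toC.mul hf1)
  rw [firstOrder_mul e.isC1_toC hf1, map_add, map_add, map_smul, map_smul,
    ← fourierMul_fourierF, ← fourierMul_fourierF, ← fourierMul_fourierF, fourierMul_toC] at h1
  exact h1

/-- The commutator `i[H(e, V), A]` is bounded if `i[V, A]` is. -/
lemma hasBoundedClosure_iCommutator (e : Dispersion d) (V : lp (fun _ : Lattice d => ℝ) ⊤)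
    {K : SeqL2 d →L[ℂ] SeqL2 d}
    (hK : HasBoundedClosure (iCommutator (potentialOp V) (conjugateOp e).closure) K) :
    HasBoundedClosure (iCommutator (hamiltonian e V) (conjugateOp e).closure)
      (fourierMul d (gradSq e.toC) + K) := by
  set A := (conjugateOp e).closure with hA
  have hh : ∀ ψ : A.domain, ∃ h : hopping e ψ ∈ A.domain, A ⟨hopping e ψ, h⟩ =
      hopping e (A ψ) + Complex.I • fourierMul d (gradSq e.toC) ψ := by
    intro ψ
    obtain ⟨y, hy, hy'⟩ := (LinearPMap.mem_graph_iff _).mp (hopping_mem_graph e (A.mem_graph ψ))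
    dsimp only at hy hy'
    have hmem : hopping e ψ ∈ A.domain := hy ▸ y.2
    exact ⟨hmem, by rw [← hy']; congr 1; exact Subtype.ext hy.symm⟩
  refine ⟨hK.1.mono ?_, ?_⟩
  · rintro ψ ⟨h1, h2⟩
    exact ⟨h1, A.domain.add_mem (hh ⟨ψ, h1⟩).1 h2⟩
  · refine ⟨fun _ _ => Submodule.mem_top, ?_⟩
    rintro ⟨ψ, h1, h2⟩ ⟨φ, hφ⟩ (rfl : ψ = φ)
    obtain ⟨h3, h4⟩ := hh ⟨ψ, h1⟩
    -- Since `h(e)` preserves the domain of `A`, the commutators with `H(e, V)` and with `V` have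
    -- the same natural domain.
    have hV : potentialOp V ψ ∈ A.domain := by
      have h5 := A.domain.sub_mem h2 h3
      have h6 : hamiltonian e V ψ - hopping e ψ = potentialOp V ψ := by
        simp [hamiltonian]
      exact h6 ▸ h5
    have h7 : Complex.I • (potentialOp V (A ⟨ψ, h1⟩) - A ⟨potentialOp V ψ, hV⟩) = K ψ :=
      hK.2.2 (x := ⟨ψ, h1, hV⟩) (y := ⟨ψ, trivial⟩) rfl
    have h8 : A ⟨hamiltonian e V ψ, h2⟩ =
        A ⟨hopping e ψ, h3⟩ + A ⟨potentialOp V ψ, hV⟩ := by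
      rw [← LinearPMap.map_add]; rfl
    change Complex.I • (hamiltonian e V (A ⟨ψ, h1⟩) - A ⟨hamiltonian e V ψ, h2⟩) =
      fourierMul d (gradSq e.toC) ψ + K ψ
    rw [h8, h4, ← h7]
    change Complex.I • (hopping e (A ⟨ψ, h1⟩) + potentialOp V (A ⟨ψ, h1⟩) - _) = _
    have hI : ∀ v : SeqL2 d, Complex.I • Complex.I • v = -v := fun v => by
      rw [smul_smul, Complex.I_mul_I, neg_one_smul]
    simp only [smul_sub, smul_add, hI]
    abel

/-! ### Compactness -/

/-- A potential vanishing at infinity is a compact operator. -/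
lemma isCompactOperator_potentialOp (V : lp (fun _ : Lattice d => ℝ) ⊤)
    (hV : Tendsto (fun x => V x) cofinite (𝓝 0)) : IsCompactOperator (potentialOp V) := by
  -- `R x` is `V` restricted to the site `x`, an operator of rank at most one. Summing over the
  -- finitely many sites with `|V| ≥ ε/2` approximates `V` within `ε/2`.
  let R : Lattice d → (SeqL2 d →L[ℂ] SeqL2 d) := fun x =>
    (ContinuousLinearMap.toSpanSingleton ℂ (lp.single 2 x (V x : ℂ) : SeqL2 d)) ∘L
      innerSL ℂ (lp.single 2 x (1 : ℂ) : SeqL2 d)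
  have hR : ∀ x, R x ∈ compactOperator (RingHom.id ℂ) (SeqL2 d) (SeqL2 d) := by
    intro x
    have h : IsCompactOperator
        (ContinuousLinearMap.toSpanSingleton ℂ (lp.single 2 x (V x : ℂ) : SeqL2 d)) :=
      isCompactOperator_of_locallyCompactSpace_rng
        (ContinuousLinearMap.toSpanSingleton ℂ (lp.single 2 x (V x : ℂ) : SeqL2 d))
    exact h.comp_clm (innerSL ℂ (lp.single 2 x (1 : ℂ) : SeqL2 d))
  have hRapply : ∀ x y (ψ : SeqL2 d), R x ψ y = if y = x then (V y : ℂ) * ψ y else 0 := by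
    intro x y ψ
    simp only [R, ContinuousLinearMap.comp_apply, innerSL_apply_apply, lp.inner_single_left,
      ContinuousLinearMap.toSpanSingleton_apply, lp.coeFn_smul, Pi.smul_apply, smul_eq_mul]
    split_ifs with h
    · subst h
      rw [lp.single_apply_self]
      simp [mul_comm]
    · rw [lp.single_apply_ne _ _ _ h, mul_zero]
  have hcl := isClosed_setOfPred_isCompactOperator (σ₁₂ := RingHom.id ℂ) (M₁ := SeqL2 d)
    (M₂ := SeqL2 d)
  refine hcl.closure_subset (Metric.mem_closure_iff.mpr fun ε hε => ?_)
  have hfin : {x | ¬ ‖V x‖ < ε / 2}.Finite := by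
    have h := (tendsto_zero_iff_norm_tendsto_zero.mp hV).eventually_lt_const (half_pos hε)
    exact h
  refine ⟨∑ x ∈ hfin.toFinset, R x,
    (compactOperator (RingHom.id ℂ) (SeqL2 d) (SeqL2 d)).sum_mem fun x _ => hR x, ?_⟩
  rw [dist_eq_norm]
  refine lt_of_le_of_lt ?_ (half_lt_self hε)
  refine ContinuousLinearMap.opNorm_le_bound _ (half_pos hε).le fun ψ => ?_
  have hψ : ε / 2 * ‖ψ‖ = ‖((ε / 2 : ℝ) : ℂ) • ψ‖ := by
    rw [norm_smul, Complex.norm_real, Real.norm_of_nonneg (half_pos hε).le]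
  rw [hψ]
  refine lp.norm_mono (by norm_num) fun y => ?_
  rw [sub_apply, lp.coeFn_sub, Pi.sub_apply, potentialOp_apply,
    sum_apply, lp.coeFn_sum, Finset.sum_apply]
  simp only [hRapply, Finset.sum_ite_eq, lp.coeFn_smul, Pi.smul_apply, norm_smul]
  split_ifs with h
  · rw [sub_self, norm_zero]; positivity
  · have h1 : ‖V y‖ < ε / 2 := by simpa using h
    rw [sub_zero, norm_mul, Complex.norm_real, Complex.norm_real,
      Real.norm_of_nonneg (half_pos hε).le]
    gcongr

/-! ### Functional calculus under compact perturbations. -/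

section CompactDifference

variable {H : Type*} [NormedAddCommGroup H] [InnerProductSpace ℂ H]

lemma isCompactOperator_mul_left {K : H →L[ℂ] H} (hK : IsCompactOperator K) (T : H →L[ℂ] H) :
    IsCompactOperator (T * K : H →L[ℂ] H) := hK.clm_comp T

lemma isCompactOperator_mul_right {K : H →L[ℂ] H} (hK : IsCompactOperator K) (T : H →L[ℂ] H) :
    IsCompactOperator (K * T : H →L[ℂ] H) := hK.comp_clm T

lemma isCompactOperator_aeval_sub {S T : H →L[ℂ] H} (h : IsCompactOperator (S - T : H →L[ℂ] H))
    (q : Polynomial ℝ) :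
    IsCompactOperator (Polynomial.aeval S q - Polynomial.aeval T q : H →L[ℂ] H) := by
  have hpow : ∀ n : ℕ, IsCompactOperator (S ^ n - T ^ n : H →L[ℂ] H) := by
    intro n
    induction n with
    | zero => simpa using isCompactOperator_zero
    | succ n ih =>
      -- Telescoping leaves a factor `S - T` or a lower difference in each term; compact operators
      -- form a two-sided ideal.
      have h1 : S ^ (n + 1) - T ^ (n + 1) = S ^ n * (S - T) + (S ^ n - T ^ n) * T := by
        rw [pow_succ, pow_succ]; noncomm_ring
      rw [h1]
      exact (isCompactOperator_mul_left h _).add (isCompactOperator_mul_right ih _)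
  induction q using Polynomial.induction_on' with
  | add p q hp hq =>
    rw [map_add, map_add, add_sub_add_comm]
    exact hp.add hq
  | monomial n a =>
    rw [Polynomial.aeval_monomial, Polynomial.aeval_monomial, ← mul_sub]
    exact isCompactOperator_mul_left (hpow n) _

end CompactDifference

section FunctionOf

variable {H : Type*} [NormedAddCommGroup H] [InnerProductSpace ℂ H] [CompleteSpace H]

lemma functionOf_sq {T : H →L[ℂ] H} (hT : IsSelfAdjoint T) {χ : ℝ → ℝ} (hχ : Continuous χ) :
    functionOf (fun t => χ t ^ 2) T = functionOf χ T * functionOf χ T := by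
  unfold functionOf
  rw [cfc_pow χ 2 T hχ.continuousOn hT, sq]

lemma norm_functionOf_sub_aeval_le {T : H →L[ℂ] H} (hT : IsSelfAdjoint T) {χ : ℝ → ℝ}
    (hχ : Continuous χ) (q : Polynomial ℝ) {ε : ℝ} (hε : 0 ≤ ε)
    -- The factor `‖1‖` lets the spectral bound hold on the zero space as well.
    (hq : ∀ x, |x| ≤ ‖T‖ * ‖(1 : H →L[ℂ] H)‖ → |q.eval x - χ x| ≤ ε) :
    ‖functionOf χ T - Polynomial.aeval T q‖ ≤ ε := by
  unfold functionOf
  rw [← cfc_polynomial q T hT, ← cfc_sub χ q.eval T hχ.continuousOn q.continuous.continuousOn]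
  refine norm_cfc_le hε fun x hx => ?_
  rw [norm_sub_rev]
  exact hq x (spectrum.norm_le_norm_mul_of_mem hx)

end FunctionOf

/-- The function `χ ∘ e`, as a continuous complex-valued function. -/
def compDispersion (χ : ℝ → ℝ) (hχ : Continuous χ) (e : Dispersion d) : C(Torus d, ℂ) :=
  ⟨fun p => (χ (e p) : ℂ), Complex.continuous_ofReal.comp (hχ.comp e.isC2.continuous)⟩

/-- `fourierMul` is an algebra homomorphism, so polynomials in `h(e)` are computed pointwise on the
symbol. -/
lemma aeval_hopping (e : Dispersion d) (q : Polynomial ℝ) :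
    Polynomial.aeval (hopping e) q =
      fourierMul d (compDispersion (fun t => q.eval t) q.continuous e) := by
  have h1 := Polynomial.aeval_algHom_apply ((fourierMul d).restrictScalars ℝ) e.toC q
  rw [AlgHom.restrictScalars_apply, AlgHom.restrictScalars_apply, fourierMul_toC] at h1
  rw [h1]
  congr 1
  ext p
  have h2 := Polynomial.aeval_algHom_apply (ContinuousMap.evalAlgHom ℝ ℂ p) e.toC q
  change Polynomial.aeval (e p : ℂ) q = (Polynomial.aeval e.toC q) p at h2
  rw [← h2]
  change Polynomial.aeval (algebraMap ℝ ℂ (e p)) q = _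
  rw [Polynomial.aeval_algebraMap_apply]
  rfl

/-- `χ(H(e, V)) - χ(h(e))` is compact if `V` is. -/
lemma isCompactOperator_functionOf_sub (e : Dispersion d) (V : lp (fun _ : Lattice d => ℝ) ⊤)
    (hV : IsCompactOperator (potentialOp V)) (χ : ℝ → ℝ) (hχ : Continuous χ) :
    IsCompactOperator (functionOf χ (hamiltonian e V) -
      fourierMul d (compDispersion χ hχ e) : SeqL2 d →L[ℂ] SeqL2 d) := by
  have hcl := isClosed_setOfPred_isCompactOperator (σ₁₂ := RingHom.id ℂ) (M₁ := SeqL2 d)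
    (M₂ := SeqL2 d)
  set T := hamiltonian e V with hT
  have hsa : IsSelfAdjoint T := isSelfAdjoint_hamiltonian e V
  refine hcl.closure_subset (Metric.mem_closure_iff.mpr fun ε hε => ?_)
  -- One interval covers both the spectrum of `H(e, V)` and the values of `e`, so a single
  -- polynomial approximates `χ` for both operators.
  set r : ℝ := max (‖T‖ * ‖(1 : SeqL2 d →L[ℂ] SeqL2 d)‖) ‖e.toC‖ with hr
  obtain ⟨q, hq⟩ := exists_polynomial_near_of_continuousOn (-r) r χ hχ.continuousOn (ε / 3)
    (by positivity)
  refine ⟨Polynomial.aeval T q - Polynomial.aeval (hopping e) q, ?_, ?_⟩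
  · refine isCompactOperator_aeval_sub ?_ q
    have h1 : T - hopping e = potentialOp V := by simp [hT, hamiltonian]
    rwa [h1]
  · have h1 : ‖functionOf χ T - Polynomial.aeval T q‖ ≤ ε / 3 :=
      norm_functionOf_sub_aeval_le hsa hχ q (by positivity) fun x hx =>
        (hq x (abs_le.mp (hx.trans (le_max_left _ _)))).le
    have h2 : ‖Polynomial.aeval (hopping e) q - fourierMul d (compDispersion χ hχ e)‖ ≤ ε / 3 := by
      rw [aeval_hopping, ← map_sub]
      refine (norm_fourierMul_le _).trans ((ContinuousMap.norm_le _ (by positivity)).mpr fun p => ?_)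
      have hp : |e p| ≤ r := by
        have h3 := ContinuousMap.norm_coe_le_norm e.toC p
        have h4 : ‖e.toC p‖ = |e p| := Complex.norm_real _
        rw [h4] at h3
        exact h3.trans (le_max_right _ _)
      change ‖((q.eval (e p) : ℝ) : ℂ) - (χ (e p) : ℂ)‖ ≤ ε / 3
      rw [← Complex.ofReal_sub, Complex.norm_real]
      exact (hq _ (abs_le.mp hp)).le
    rw [dist_eq_norm]
    have h3 : functionOf χ T - fourierMul d (compDispersion χ hχ e) -
        (Polynomial.aeval T q - Polynomial.aeval (hopping e) q) =
        (functionOf χ T - Polynomial.aeval T q) +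
          (Polynomial.aeval (hopping e) q - fourierMul d (compDispersion χ hχ e)) := by abel
    rw [h3]
    refine (norm_add_le _ _).trans_lt ?_
    linarith

/-! ### The Mourre estimate -/

lemma gradSq_toC_apply (e : Dispersion d) (p : Torus d) :
    gradSq e.toC p = ((∑ k, partialDeriv k e.toFun p ^ 2 : ℝ) : ℂ) := by
  simp only [gradSq, ContinuousMap.coe_sum, Finset.sum_apply, ContinuousMap.mul_apply,
    Dispersion.coe_pderiv_toC]
  push_cast
  exact Finset.sum_congr rfl fun k _ => (sq _).symm

/-- Away from thresholds, `|∇e|²` is bounded from below. -/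
lemma exists_le_sum_sq_partialDeriv (e : Dispersion d) {χ : ℝ → ℝ}
    (h : ∃ δ > 0, ∀ s ∈ thresholds e, ∀ t ∈ tsupport χ, δ ≤ |s - t|) :
    ∃ c : ℝ, 0 < c ∧ ∀ p, χ (e p) ≠ 0 → c ≤ ∑ k, partialDeriv k e.toFun p ^ 2 := by
  obtain ⟨δ, hδ, hdist⟩ := h
  have hcpt : IsCompact (e.toFun ⁻¹' tsupport χ) :=
    ((isClosed_tsupport χ).preimage e.isC2.continuous).isCompact
  have hcont : Continuous fun p => ∑ k, partialDeriv k e.toFun p ^ 2 :=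
    continuous_finsetSum _ fun k _ =>
      ((IsCn.partialDeriv (n := 1) e.isC2 k).continuous).pow 2
  have hpos : ∀ p ∈ e.toFun ⁻¹' tsupport χ, 0 < ∑ k, partialDeriv k e.toFun p ^ 2 := by
    intro p hp
    refine lt_of_le_of_ne (Finset.sum_nonneg fun _ _ => sq_nonneg _) fun h0 => ?_
    have hcrit : p ∈ crit e := fun k => by
      have h1 := (Finset.sum_eq_zero_iff_of_nonneg fun _ _ => sq_nonneg _).mp h0.symm k
        (Finset.mem_univ k)
      exact pow_eq_zero_iff (two_ne_zero) |>.mp h1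
    -- At a critical point `e p` would be both a threshold and a point of the support, at distance
    -- zero.
    have h2 := hdist (e p) ⟨p, hcrit, rfl⟩ (e p) hp
    rw [sub_self, abs_zero] at h2
    linarith
  obtain ⟨c, hc, hle⟩ := hcpt.exists_forall_le' hcont.continuousOn hpos
  exact ⟨c, hc, fun p hp => hle p (subset_tsupport χ hp)⟩

/-- Replacing `χ(H)` by `χ(h(e))` costs a compact operator and turns the claim, up to `K₀`, into
positivity of the multiplier `χ(e)²(|∇e|² - c)`. -/
lemma mourre_estimate (e : Dispersion d) (V : lp (fun _ : Lattice d => ℝ) ⊤)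
    (hV : IsCompactOperator (potentialOp V)) {K₀ : SeqL2 d →L[ℂ] SeqL2 d}
    (hK₀ : IsCompactOperator K₀) (χ : ℝ → ℝ) (hχ : Continuous χ)
    (h : ∃ δ > 0, ∀ s ∈ thresholds e, ∀ t ∈ tsupport χ, δ ≤ |s - t|) :
    ∃ c : ℝ, 0 < c ∧ ∃ K : SeqL2 d →L[ℂ] SeqL2 d, IsCompactOperator K ∧
      c • functionOf (fun t => χ t ^ 2) (hamiltonian e V) + K ≤
        functionOf χ (hamiltonian e V) * (fourierMul d (gradSq e.toC) + K₀) *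
          functionOf χ (hamiltonian e V) := by
  obtain ⟨c, hc, hle⟩ := exists_le_sum_sq_partialDeriv e h
  set n := compDispersion χ hχ e with hn
  set A := functionOf χ (hamiltonian e V) with hA
  set X := fourierMul d n with hX
  set M := fourierMul d (gradSq e.toC) with hM
  have hsq : functionOf (fun t => χ t ^ 2) (hamiltonian e V) = A * A :=
    functionOf_sq (isSelfAdjoint_hamiltonian e V) hχ
  have hD : IsCompactOperator (A - X : SeqL2 d →L[ℂ] SeqL2 d) :=
    isCompactOperator_functionOf_sub e V hV χ hχ
  -- The second summand is `A(M - c)A - X(M - c)X`, written so that each term contains the compact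
  -- factor `A - X`. Subtracting the whole operator leaves exactly `X(M - c)X ≥ 0`.
  refine ⟨c, hc, A * K₀ * A + (A * (M - c • 1) * (A - X) + (A - X) * ((M - c • 1) * X)), ?_, ?_⟩
  · exact (isCompactOperator_mul_right (isCompactOperator_mul_left hK₀ A) A).add
      ((isCompactOperator_mul_left hD _).add (isCompactOperator_mul_right hD _))
  · have hnonneg : 0 ≤ fourierMul d (n * (gradSq e.toC - (c : ℂ) • 1) * n) := by
      refine fourierMul_nonneg
        (fun p => χ (e p) ^ 2 * (∑ k, partialDeriv k e.toFun p ^ 2 - c)) ?_ ?_ ?_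
      · refine ((hχ.comp e.isC2.continuous).pow 2).mul (Continuous.sub ?_ continuous_const)
        exact continuous_finsetSum _ fun k _ =>
          ((IsCn.partialDeriv (n := 1) e.isC2 k).continuous).pow 2
      · intro p
        by_cases hp : χ (e p) = 0
        · simp [hp]
        · exact mul_nonneg (sq_nonneg _) (sub_nonneg.mpr (hle p hp))
      · intro p
        simp only [ContinuousMap.mul_apply, ContinuousMap.sub_apply, ContinuousMap.smul_apply,
          ContinuousMap.one_apply, gradSq_toC_apply, smul_eq_mul, mul_one]
        change (χ (e p) : ℂ) * _ * (χ (e p) : ℂ) = _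
        push_cast
        ring
    have hcsmul : (c : ℂ) • (1 : SeqL2 d →L[ℂ] SeqL2 d) = c • 1 := Complex.coe_smul c _
    rw [map_mul, map_mul, map_sub, map_smul, map_one, hcsmul] at hnonneg
    change 0 ≤ X * (M - c • 1) * X at hnonneg
    rw [← sub_nonneg, hsq]
    convert! hnonneg using 1
    simp only [smul_sub, mul_add, add_mul, mul_sub, sub_mul, smul_mul_assoc, mul_smul_comm, one_mul,
      mul_one, mul_assoc]
    abel

end LatticeSchrodinger

end

/-! ### Assembly of self-adjointness, commutator and Mourre estimate. -/

theorem mainTheorem10 (d : ℕ) (e : Dispersion d) (he : IsCn 4 e.toFun) :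
    -- `A(e)` is symmetric, and its closure is its unique self-adjoint extension
    ((conjugateOp e).IsFormalAdjoint (conjugateOp e) ∧
      IsSelfAdjoint (conjugateOp e).closure ∧
      ∀ B : SeqL2 d →ₗ.[ℂ] SeqL2 d, conjugateOp e ≤ B → IsSelfAdjoint B →
        B = (conjugateOp e).closure) ∧
    -- the Mourre estimate
    ∀ V : lp (fun _ : Lattice d => ℝ) ⊤, Tendsto (fun x => V x) cofinite (𝓝 0) →
      (∃ K : SeqL2 d →L[ℂ] SeqL2 d, IsCompactOperator K ∧
        HasBoundedClosure (iCommutator (potentialOp V) (conjugateOp e).closure) K) →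
      ∃ C : SeqL2 d →L[ℂ] SeqL2 d,
        HasBoundedClosure (iCommutator (hamiltonian e V) (conjugateOp e).closure) C ∧
        ∀ χ : ℝ → ℝ, Continuous χ → HasCompactSupport χ →
          (∃ δ > 0, ∀ s ∈ thresholds e, ∀ t ∈ tsupport χ, δ ≤ |s - t|) →
          ∃ c : ℝ, 0 < c ∧ ∃ K : SeqL2 d →L[ℂ] SeqL2 d, IsCompactOperator K ∧
            c • functionOf (fun t => χ t ^ 2) (hamiltonian e V) + K ≤
              functionOf χ (hamiltonian e V) * C * functionOf χ (hamiltonian e V) := by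
  have hsa : IsSelfAdjoint (conjugateOp e).closure :=
    isSelfAdjoint_closure_conjugateOp e (ContDiff.of_le (n := 4) he (by norm_num))
  refine ⟨⟨conjugateOp_isFormalAdjoint e, hsa, fun B hle hB =>
    LinearPMap.eq_closure_of_isSelfAdjoint hsa hB hle⟩, ?_⟩
  rintro V hV ⟨K, hK, hKc⟩
  exact ⟨_, hasBoundedClosure_iCommutator e V hKc, fun χ hχ _ h =>
    mourre_estimate e V (isCompactOperator_potentialOp V hV) hK χ hχ h⟩
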